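/- **Setting.** Let $(\mathbb X,d)$ be a complete separable metric space with its Borel $\sigma$-algebra, $\mathbb U$ a nonempty finite metric space of actions, $\mathcal T(\cdot|x,u)$ a controlled transition kernel on $\mathbb X$ (jointly measurable, probability-measure valued) and $c:\mathbb X\times\mathbb U\to[0,\infty)$ a cost. An admissible policy $\gamma$ chooses $U_t$ at random, measurably, given the history $(X_0,U_0,\dots,X_{t-1},U_{t-1},X_t)$. Put $$J_\beta(c,\mathcal T,\gamma)(x)=\mathbb E^{\mathcal T,\gamma}\Big[\sum_{t\ge0}\beta^tc(X_t,U_t)\,\Big|\,X_0=x\Big],\qquad J_\infty(c,\mathcal T,\gamma)(x)=\limsup_{n\to\infty}\frac1n\,\mathbb E^{\mathcal T,\gamma}\Big[\sum_{t<n}c(X_t,U_t)\,\Big|\,X_0=x\Big],$$ and let $J^*_\beta(c,\mathcal T)(x)$, $J^*_\infty(c,\mathcal T)(x)$ be the infima over all admissible policies. For constants $K$, $L_c$, $L_{\mathcal T}$, the model is called *regular* if $0\le c\le K$; $c$ is continuous; $(x,u)\mapsto\int v\,d\mathcal T(\cdot|x,u)$ is continuous for every bounded continuous $v$; $c(\cdot,u)$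 is $L_c$-Lipschitz for every $u$; and $\mathcal W_1(\mathcal T(\cdot|x,u),\mathcal T(\cdot|y,u))\le L_{\mathcal T}\,d(x,y)$ for all $u,x,y$, where $\mathcal W_1$ is the Wasserstein-1 distance. Let $B_1,\dots,B_M$ be a measurable partition of $\mathbb X$, $\delta_M=\max_i\operatorname{diam}B_i\in[0,\infty]$, and let $\pi$ be a probability measure on $\mathbb X$ with $\pi(B_i)>0$ for all $i$. Put $\mathcal T^{\pi,M}(j|i,u)=\pi(B_i)^{-1}\int_{B_i}\mathcal T(B_j|x,u)\,\pi(dx)$, and let $\kappa_{\mathcal T,M}$ be the smallest nonzero value of $\mathcal T^{\pi,M}(j|i,u)$ over all $i,j,u$. For $N_0\ge1$ and every $i\in[M]$, $u\in\mathbb U$, let $(X_{k,i,u},Y_{k,i,u})$, $1\le k\le N_0$, be independent, with $X_{k,i,u}\sim\pi(\cdot\,|\,B_i)$ and $Y_{k,i,u}\,|\,X_{k,i,u}\sim\mathcal T(\cdot|X_{k,i,u},u)$. Define a finite model on the set of labels $[M]$ by $$\hat c(i,u)=\frac1{N_0}\sum_kc(X_{k,i,u},u),\qquad\hat{\mathcal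 T}(j|i,u)=\frac1{N_0}\sum_k\mathbf 1\{Y_{k,i,u}\in B_j\}.$$ Let $\hat\gamma_\beta,\hat\gamma_\infty:[M]\to\mathbb U$ be (measurably selected) optimal deterministic stationary policies of the finite model $([M],\mathbb U,\hat{\mathcal T},\hat c)$ for the $\beta$-discounted and the average cost criterion, i.e. policies that attain the optimal cost from every state. For the average cost, $\hat\gamma_\infty$ is moreover required, whenever the average cost optimality equation $g+h(i)=\min_u\{\hat c(i,u)+\sum_jh(j)\hat{\mathcal T}(j|i,u)\}$, $i\in[M]$, has a solution, to attain the minimum for every $i$ in that equation for some solution $(g,h)$. Extend the policies to $\mathbb X$ by $\bar\gamma(x)=\hat\gamma(i)$ for $x\in B_i$. **Theorem.** (1) Let $\beta\in(0,1)$ and $\beta L_{\mathcal T}<1$. There is a constant $C>0$, depending only on $L_c,L_{\mathcal T},K,\beta$, such that for every regular model with these constants and all $M,(B_i),\pi,N_0$ as above $$\mathbb E\big\|J_\beta(c,\mathcal T,\bar\gamma_\beta)-J_\beta^*(c,\mathcal T)\big\|_\infty\le C\Big(\delta_M+\sqrt{\tfrac{\log(M|\mathbb U|)}{N_0}}\Big).$$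 (2) Let $\epsilon>0$ and $L_{\mathcal T}<1$. There is a constant $C>0$, depending only on $L_c,L_{\mathcal T},K,\epsilon$, such that for every regular model with these constants for which some probability measure $\rho$ satisfies $\mathcal T(A|x,u)\ge\epsilon\rho(A)$ for all $x,u$ and all measurable $A$, and all $M,(B_i),\pi,N_0$ as above, $$\mathbb E\big\|J_\infty(c,\mathcal T,\bar\gamma_\infty)-J_\infty^*(c,\mathcal T)\big\|_\infty\le C\Big(\delta_M+\sqrt{\tfrac{\log(M|\mathbb U|)}{N_0}}\Big)+C\,M^2|\mathbb U|\,e^{-C^{-1}\kappa_{\mathcal T,M}N_0}.$$ -/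

import Mathlib

open MeasureTheory ProbabilityTheory Filter
open scoped ENNReal NNReal

set_option linter.unusedSectionVars false

noncomputable section

namespace MDP

/-! ### Markov decision processes

A Markov decision process on a state space `S` and an action space `U` is given by a controlled
transition kernel `T : Kernel (S × U) S` (a Markov kernel) and a stage cost `c : S → U → ℝ`. -/

section Model

variable {S U : Type*} [MeasurableSpace S] [MeasurableSpace U]

/-- Histories at time `t`: the state-action pairs at times `0, …, t - 1` and the state at time `t`,
that is, `S ^ (t + 1) × U ^ t` up to the order of the factors. -/
abbrev History (S U : Type*) (t : ℕ) : Type _ := (Fin t → S × U) × S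

/-- An admissible policy: at each time a measurable map from histories to probability measures on
the actions, i.e. a Markov kernel. -/
structure Policy (S U : Type*) [MeasurableSpace S] [MeasurableSpace U] where
  kernel : (t : ℕ) → Kernel (History S U t) U
  isMarkovKernel : ∀ t, IsMarkovKernel (kernel t)

instance (γ : Policy S U) (t : ℕ) : IsMarkovKernel (γ.kernel t) := γ.isMarkovKernel t

/-- The deterministic stationary policy `U_t = f (X_t)`. -/
def Policy.stationary (f : S → U) (hf : Measurable f) : Policy S U where
  kernel _ := Kernel.deterministic (fun h => f h.2) (hf.comp measurable_snd)
  isMarkovKernel _ := inferInstance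

/-- The conditional law of `(X_{n+1}, U_{n+1})` given `(X_i, U_i)` for `i ≤ n`:
`X_{n+1} ∼ T(· | X_n, U_n)`, then `U_{n+1}` is drawn by the policy from the history. -/
def stepKernel (T : Kernel (S × U) S) (γ : Policy S U) (n : ℕ) :
    Kernel (∀ _ : Finset.Iic n, S × U) (S × U) :=
  (T.comap (fun p => p ⟨n, Finset.mem_Iic.2 le_rfl⟩) (measurable_pi_apply _)) ⊗ₖ
    ((γ.kernel (n + 1)).comap
      (fun q => ((fun i : Fin (n + 1) => q.1 ⟨i, Finset.mem_Iic.2 (Nat.lt_succ_iff.1 i.2)⟩), q.2))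
      (by fun_prop))

instance (T : Kernel (S × U) S) [IsMarkovKernel T] (γ : Policy S U) (n : ℕ) :
    IsMarkovKernel (stepKernel T γ n) := by
  unfold stepKernel; infer_instance

/-- The law of `(X_0, U_0)` when `X_0 = x`. -/
def initialLaw (γ : Policy S U) (x : S) : Measure (S × U) :=
  (Measure.dirac x) ⊗ₘ
    ((γ.kernel 0).comap (fun s => ((fun i : Fin 0 => i.elim0), s)) (by fun_prop))

instance (γ : Policy S U) (x : S) : IsProbabilityMeasure (initialLaw γ x) := by
  unfold initialLaw; infer_instance

/-- The law of the controlled process `(X_t, U_t)_{t ≥ 0}` started at `X_0 = x`. -/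
def pathLaw (T : Kernel (S × U) S) [IsMarkovKernel T] (γ : Policy S U) (x : S) :
    Measure (ℕ → S × U) :=
  Kernel.trajMeasure (X := fun _ => S × U) (initialLaw γ x) (stepKernel T γ)

/-- `J_β(c, T, γ)(x)`. -/
def discountedCost (β : ℝ) (c : S → U → ℝ) (T : Kernel (S × U) S) [IsMarkovKernel T]
    (γ : Policy S U) (x : S) : ℝ :=
  ∫ ω, ∑' t : ℕ, β ^ t * c (ω t).1 (ω t).2 ∂(pathLaw T γ x)

/-- `J_β^*(c, T)(x)`: the infimum over all admissible policies. -/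
def optDiscountedCost (β : ℝ) (c : S → U → ℝ) (T : Kernel (S × U) S) [IsMarkovKernel T]
    (x : S) : ℝ :=
  ⨅ γ : Policy S U, discountedCost β c T γ x

/-- `J_∞(c, T, γ)(x)`. -/
def averageCost (c : S → U → ℝ) (T : Kernel (S × U) S) [IsMarkovKernel T]
    (γ : Policy S U) (x : S) : ℝ :=
  limsup (fun n : ℕ =>
    (1 / (n : ℝ)) * ∫ ω, ∑ t ∈ Finset.range n, c (ω t).1 (ω t).2 ∂(pathLaw T γ x)) atTop

/-- `J_∞^*(c, T)(x)`: the infimum over all admissible policies. -/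
def optAverageCost (c : S → U → ℝ) (T : Kernel (S × U) S) [IsMarkovKernel T] (x : S) : ℝ :=
  ⨅ γ : Policy S U, averageCost c T γ x

/-- `f` is an optimal deterministic stationary policy for the `β`-discounted criterion. -/
def IsDiscountedOptimal (β : ℝ) (c : S → U → ℝ) (T : Kernel (S × U) S) [IsMarkovKernel T]
    (f : S → U) : Prop :=
  ∃ hf : Measurable f, ∀ x,
    discountedCost β c T (Policy.stationary f hf) x = optDiscountedCost β c T x

/-- `(g, h, f)` is a canonical triplet: `h` is bounded and measurable, `(g, h)` solves the average
cost optimality equation, and the stationary policy `f` attains the infimum in it. -/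
def IsCanonicalTriplet (c : S → U → ℝ) (T : Kernel (S × U) S) (g : ℝ) (h : S → ℝ)
    (f : S → U) : Prop :=
  Measurable h ∧ (∃ K : ℝ, ∀ x, |h x| ≤ K) ∧ Measurable f ∧
    (∀ x, g + h x = ⨅ u, (c x u + ∫ y, h y ∂(T (x, u)))) ∧
    ∀ x, g + h x = c x (f x) + ∫ y, h y ∂(T (x, f x))

/-- `f` is an optimal deterministic stationary policy for the average cost criterion: it attains
the optimal average cost from every state and, if the average cost optimality equation is solvable
at all, `f` is part of a canonical triplet. -/
def IsAverageOptimal (c : S → U → ℝ) (T : Kernel (S × U) S) [IsMarkovKernel T]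
    (f : S → U) : Prop :=
  (∃ hf : Measurable f, ∀ x,
    averageCost c T (Policy.stationary f hf) x = optAverageCost c T x) ∧
  ((∃ g h f', IsCanonicalTriplet c T g h f') → ∃ g h, IsCanonicalTriplet c T g h f)

/-- `‖J_β(c, T, f) - J_β^*(c, T)‖_∞`, as an extended nonnegative real. -/
def discountedError (β : ℝ) (c : S → U → ℝ) (T : Kernel (S × U) S) [IsMarkovKernel T]
    (f : S → U) (hf : Measurable f) : ℝ≥0∞ :=
  ⨆ x, ENNReal.ofReal
    |discountedCost β c T (Policy.stationary f hf) x - optDiscountedCost β c T x|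

/-- `‖J_∞(c, T, f) - J_∞^*(c, T)‖_∞`, as an extended nonnegative real. -/
def averageError (c : S → U → ℝ) (T : Kernel (S × U) S) [IsMarkovKernel T]
    (f : S → U) (hf : Measurable f) : ℝ≥0∞ :=
  ⨆ x, ENNReal.ofReal
    |averageCost c T (Policy.stationary f hf) x - optAverageCost c T x|

/-- The kernel `T` satisfies the minorization condition with `ρ` and `ε`. -/
def IsMinorized (T : Kernel (S × U) S) (ρ : Measure S) (ε : ℝ) : Prop :=
  ∀ x u, ∀ A : Set S, MeasurableSet A → ENNReal.ofReal ε * ρ A ≤ T (x, u) A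

end Model

/-! ### Wasserstein regular models -/

section Regular

variable {X U : Type*}

/-- The Wasserstein-1 distance: the infimum of transport costs over all couplings. -/
def wasserstein1 [PseudoEMetricSpace X] [MeasurableSpace X] (μ ν : Measure X) : ℝ≥0∞ :=
  ⨅ (θ : Measure (X × X)) (_ : θ.map Prod.fst = μ ∧ θ.map Prod.snd = ν),
    ∫⁻ p, edist p.1 p.2 ∂θ

/-- The model `(c, T)` is Wasserstein regular, with cost bound `K`, cost Lipschitz constant `Lc`
and kernel Lipschitz constant `LT` (both in the state variable, uniformly in the action). -/
structure IsWassersteinRegular [MetricSpace X] [MeasurableSpace X] [MetricSpace U]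
    [MeasurableSpace U] (c : X → U → ℝ) (T : Kernel (X × U) X) (K : ℝ) (Lc LT : ℝ≥0) : Prop where
  compact_actions : CompactSpace U
  cost_nonneg : ∀ x u, 0 ≤ c x u
  cost_le : ∀ x u, c x u ≤ K
  cost_continuous : Continuous (fun p : X × U => c p.1 p.2)
  kernel_continuous : ∀ v : BoundedContinuousFunction X ℝ,
    Continuous (fun p : X × U => ∫ y, v y ∂(T p))
  cost_lipschitz : ∀ u, LipschitzWith Lc (fun x => c x u)
  kernel_lipschitz : ∀ u x y, wasserstein1 (T (x, u)) (T (y, u)) ≤ LT * edist x y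

end Regular

/-! ### Quantization -/

/-- A measurable partition of `X` into `M` bins. -/
structure BinPartition (X : Type*) [MeasurableSpace X] (M : ℕ) where
  bin : Fin M → Set X
  measurableSet_bin : ∀ i, MeasurableSet (bin i)
  disjoint : Pairwise (fun i j => Disjoint (bin i) (bin j))
  iUnion_eq : ⋃ i, bin i = Set.univ

section Quantization

variable {X U : Type*} [MeasurableSpace X] [MeasurableSpace U] {M : ℕ}

namespace BinPartition

lemma exists_mem (B : BinPartition X M) (x : X) : ∃ i, x ∈ B.bin i := by
  have h : x ∈ ⋃ i, B.bin i := B.iUnion_eq ▸ Set.mem_univ x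
  simpa using h

/-- The quantizer: the label of the bin that contains `x`. -/
def index (B : BinPartition X M) (x : X) : Fin M := (B.exists_mem x).choose

lemma mem_bin_index (B : BinPartition X M) (x : X) : x ∈ B.bin (B.index x) :=
  (B.exists_mem x).choose_spec

lemma index_eq_iff (B : BinPartition X M) (x : X) (i : Fin M) : B.index x = i ↔ x ∈ B.bin i := by
  refine ⟨fun h => h ▸ B.mem_bin_index x, fun h => ?_⟩
  by_contra hne
  exact Set.disjoint_left.1 (B.disjoint hne) (B.mem_bin_index x) h

lemma measurable_index (B : BinPartition X M) : Measurable B.index := by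
  refine measurable_to_countable' fun i => ?_
  have h : B.index ⁻¹' {i} = B.bin i := by
    ext x; simpa using B.index_eq_iff x i
  rw [h]; exact B.measurableSet_bin i

/-- The quantization error `δ_M`, the largest diameter of a bin. -/
def mesh {X : Type*} [MetricSpace X] [MeasurableSpace X] (B : BinPartition X M) : ℝ≥0∞ :=
  ⨆ i, Metric.ediam (B.bin i)

/-- The piecewise constant extension to `X` of a policy on the bin labels. -/
def extend (B : BinPartition X M) (f : Fin M → U) : X → U := fun x => f (B.index x)

lemma measurable_extend (B : BinPartition X M) (f : Fin M → U) : Measurable (B.extend f) :=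
  (Measurable.of_discrete (f := f)).comp B.measurable_index

/-- `T^{π,M}(j | i, u)`: the transition probabilities of the quantized model; the label `i` stands
for the representative of the `i`-th bin. -/
def quantizedTransition (B : BinPartition X M) (π : Measure X) (T : Kernel (X × U) X)
    (i : Fin M) (u : U) (j : Fin M) : ℝ :=
  (∫ x in B.bin i, (T (x, u)).real (B.bin j) ∂π) / π.real (B.bin i)

/-- `κ_{T,M}`: the smallest nonzero transition probability of the quantized model. -/
def kappa (B : BinPartition X M) (π : Measure X) (T : Kernel (X × U) X) : ℝ :=
  sInf {r : ℝ | 0 < r ∧ ∃ i u j, r = B.quantizedTransition π T i u j}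

/-! ### The learned model -/

variable {N₀ : ℕ}

/-- The estimated cost, from the sampled states `xs k i u`. -/
def estCost (c : X → U → ℝ) (xs : Fin N₀ → Fin M → U → X) (i : Fin M) (u : U) : ℝ :=
  (1 / (N₀ : ℝ)) * ∑ k, c (xs k i u) u

/-- The estimated transition probabilities, from the sampled successor states `ys k i u`. -/
def estTransition (B : BinPartition X M) (ys : Fin N₀ → Fin M → U → X) (i : Fin M) (u : U)
    (j : Fin M) : ℝ :=
  (1 / (N₀ : ℝ)) * ∑ k, (B.bin j).indicator (fun _ => (1 : ℝ)) (ys k i u)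

/-- The estimated transition probabilities, as a controlled kernel on the bin labels. -/
def estKernel [Countable U] [MeasurableSingletonClass U] (B : BinPartition X M)
    (ys : Fin N₀ → Fin M → U → X) : Kernel (Fin M × U) (Fin M) where
  toFun p := ∑ j, ENNReal.ofReal (B.estTransition ys p.1 p.2 j) • Measure.dirac j
  measurable' := Measurable.of_discrete

lemma estTransition_nonneg (B : BinPartition X M) (ys : Fin N₀ → Fin M → U → X) (i : Fin M)
    (u : U) (j : Fin M) : 0 ≤ B.estTransition ys i u j := by
  refine mul_nonneg (by positivity) (Finset.sum_nonneg fun k _ => ?_)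
  exact Set.indicator_nonneg (fun _ _ => zero_le_one) _

lemma sum_estTransition [NeZero N₀] (B : BinPartition X M) (ys : Fin N₀ → Fin M → U → X)
    (i : Fin M) (u : U) : ∑ j, B.estTransition ys i u j = 1 := by
  have h (x : X) : ∑ j, (B.bin j).indicator (fun _ => (1 : ℝ)) x = 1 := by
    classical
    simp [Set.indicator_apply, ← B.index_eq_iff]
  have hN : (N₀ : ℝ) ≠ 0 := Nat.cast_ne_zero.2 (NeZero.ne N₀)
  simp only [estTransition]
  rw [← Finset.mul_sum, Finset.sum_comm]
  simp [h, hN]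

instance [Countable U] [MeasurableSingletonClass U] [NeZero N₀] (B : BinPartition X M)
    (ys : Fin N₀ → Fin M → U → X) : IsMarkovKernel (B.estKernel ys) where
  isProbabilityMeasure p := by
    constructor
    change (∑ j, ENNReal.ofReal (B.estTransition ys p.1 p.2 j) • Measure.dirac j :
      Measure (Fin M)) Set.univ = 1
    rw [Measure.finsetSum_apply]
    have h (j : Fin M) : (ENNReal.ofReal (B.estTransition ys p.1 p.2 j) •
        (Measure.dirac j : Measure (Fin M))) Set.univ =
        ENNReal.ofReal (B.estTransition ys p.1 p.2 j) := by
      rw [Measure.smul_apply, measure_univ, smul_eq_mul, mul_one]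
    rw [Finset.sum_congr rfl fun j _ => h j,
      ← ENNReal.ofReal_sum_of_nonneg fun j _ => B.estTransition_nonneg ys p.1 p.2 j,
      B.sum_estTransition, ENNReal.ofReal_one]

end BinPartition

/-- For every bin `i` and action `u`, the pairs `(xs k i u, ys k i u)`, `k < N₀`, are independent,
`xs k i u` has the law of `π` conditioned on the bin, and `ys k i u` given `xs k i u = x` has the
law `T(· | x, u)`. -/
structure IsTransitionSample {Ω : Type*} [MeasurableSpace Ω] {N₀ : ℕ} (P : Measure Ω)
    (B : BinPartition X M) (π : Measure X) (T : Kernel (X × U) X)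
    (xs ys : Ω → Fin N₀ → Fin M → U → X) : Prop where
  hasLaw : ∀ k i u, HasLaw (fun ω => (xs ω k i u, ys ω k i u))
    ((ProbabilityTheory.cond π (B.bin i)) ⊗ₘ
      (T.comap (fun x => (x, u)) (measurable_id.prodMk measurable_const))) P
  indep : ∀ i u, iIndepFun (fun k ω => (xs ω k i u, ys ω k i u)) P

end Quantization

end MDP

end

/-! Both criteria are treated by one contraction argument, applied to the sub-stochastic kernel `β •
T - η • ρ`. The discounted case is `η = 0`. The average case is `β = 1`, `η = ε / 2`, where the
minorization makes the Bellman operator a contraction of modulus `1 - η`, and a fixed point `v`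
solves the average cost optimality equation with gain `η * ∫ v dρ`.

Performance difference formulas express the cost of any policy as the value `v` (or the gain) plus
the accumulated expected `bellmanGap`. For a fixed point the gap is nonnegative and vanishes for
some action, so `v` (or the gain) is optimal, and a stationary policy whose gap is at most `e`
everywhere loses at most `e / (1 - β)`, respectively `e`. It remains to bound the gap of the learned
policy.

The learned policy is greedy for a fixed point `w` of the Bellman operator of the finite model. By
contraction, `w` is as close to `v` at representatives of the bins as the one-step values of `v` are
in the two models (`qValue_sub_le_of_greedy`). These differ by a quantization error, controlled
because `v` is Lipschitz (`exists_lipschitz_fixedPoint`), and by a statistical error. Since `v`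
depends on the true model only, the latter involves a single fixed function: a maximum over the `M *
|U|` pairs of sub-Gaussian means, of expected order `√(log (M * |U|) / N₀)`.

For the average cost the learned model must be minorized too. It inherits `ε / 2` when every
empirical transition probability is at least half of the true one; a Chernoff and a union bound make
the exceptional event exponentially unlikely, and there the error is at most `K`. -/

noncomputable section

namespace MDP

/-! ### Marginal laws of the controlled process -/

section Marginals

variable {S U : Type*} [MeasurableSpace S] [MeasurableSpace U]

/-- The law of the state-action pair at time `t`. -/
def stateActionLaw (T : Kernel (S × U) S) [IsMarkovKernel T] (γ : Policy S U) (x : S) (t : ℕ) :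
    Measure (S × U) :=
  (pathLaw T γ x).map (fun ω => ω t)

variable (T : Kernel (S × U) S) [IsMarkovKernel T] (γ : Policy S U) (x : S)

instance : IsProbabilityMeasure (pathLaw T γ x) := by
  unfold pathLaw; infer_instance

instance (t : ℕ) : IsProbabilityMeasure (stateActionLaw T γ x t) :=
  Measure.isProbabilityMeasure_map (measurable_pi_apply t).aemeasurable

lemma stateActionLaw_zero : stateActionLaw T γ x 0 = initialLaw γ x := by
  unfold stateActionLaw pathLaw Kernel.trajMeasure
  rw [Measure.map_comp _ _ (by fun_prop)]
  have h : (Kernel.traj (X := fun _ => S × U) (stepKernel T γ) 0).map (fun ω => ω 0) =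
      Kernel.deterministic (fun p : (∀ _ : Finset.Iic 0, S × U) => p ⟨0, by simp⟩)
        (by fun_prop) := by
    -- The coordinate at time 0 factors through the restriction to times up to 0, where the
    -- trajectory kernel is the identity.
    have h1 : (fun ω : ℕ → S × U => ω 0) =
      (fun p : (∀ _ : Finset.Iic 0, S × U) => p ⟨0, by simp⟩) ∘
        (Preorder.frestrictLe (π := fun _ => S × U) 0) := rfl
    rw [h1, Kernel.map_comp_right _ (Preorder.measurable_frestrictLe 0) (by fun_prop),
      Kernel.traj_map_frestrictLe,
      Kernel.partialTraj_self]
    ext p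
    rw [Kernel.map_apply _ (by fun_prop), Kernel.id_apply, Measure.map_dirac' (by fun_prop),
      Kernel.deterministic_apply]
  rw [h, Measure.deterministic_comp_eq_map, Measure.map_map (by fun_prop) (by fun_prop)]
  convert Measure.map_id
  ext p <;> rfl

/-- A policy may use the whole past, so the law at time `t + 1` is driven by the law of the entire
history, not by the marginal at time `t`. -/
lemma stateActionLaw_succ (t : ℕ) :
    stateActionLaw T γ x (t + 1) =
      stepKernel T γ t ∘ₘ ((pathLaw T γ x).map (Preorder.frestrictLe t)) := by
  have h := Kernel.map_frestrictLe_trajMeasure_compProd_eq_map_trajMeasure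
    (X := fun _ => S × U) (μ₀ := initialLaw γ x) (κ := stepKernel T γ) (a := t)
  have h2 := congrArg Measure.snd h
  rw [Measure.snd_compProd, Measure.snd_map_prodMk (by fun_prop)] at h2
  exact h2.symm

lemma fst_stateActionLaw_zero : (stateActionLaw T γ x 0).map Prod.fst = Measure.dirac x := by
  rw [stateActionLaw_zero]
  exact Measure.fst_compProd _ _

/-- The state component of the step kernel reads only the last pair, so the state marginals evolve
by `T` even under a history-dependent policy. This is what lets the performance difference formulas
cover all admissible policies. -/
lemma fst_stateActionLaw_succ (t : ℕ) :
    (stateActionLaw T γ x (t + 1)).map Prod.fst = T ∘ₘ stateActionLaw T γ x t := by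
  rw [stateActionLaw_succ, Measure.map_comp _ _ measurable_fst]
  have h : (stepKernel T γ t).map Prod.fst =
      T.comap (fun p => p ⟨t, Finset.mem_Iic.2 le_rfl⟩) (measurable_pi_apply _) := by
    rw [← Kernel.fst_eq]
    exact Kernel.fst_compProd _ _
  rw [h, ← Kernel.comp_deterministic_eq_comap, ← Measure.comp_assoc,
    Measure.deterministic_comp_eq_map,
    Measure.map_map (by fun_prop) (by fun_prop)]
  rfl

lemma ae_stateActionLaw_stationary [Countable U] [MeasurableSingletonClass U] (f : S → U)
    (hf : Measurable f) (t : ℕ) :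
    ∀ᵐ p ∂(stateActionLaw T (Policy.stationary f hf) x t), p.2 = f p.1 := by
  have hA : MeasurableSet {p : S × U | p.2 = f p.1} :=
    measurableSet_eq_fun measurable_snd (hf.comp measurable_fst)
  cases t with
  | zero =>
    rw [stateActionLaw_zero]
    unfold initialLaw
    rw [Measure.ae_compProd_iff hA]
    refine ae_of_all _ fun y => ?_
    simp only [Policy.stationary, Kernel.comap_apply, Kernel.deterministic_apply]
    rw [ae_dirac_iff (measurableSet_eq)]
  | succ t =>
    rw [stateActionLaw_succ, ae_iff]
    change (Measure.bind _ _) ({p : S × U | p.2 = f p.1}ᶜ) = 0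
    rw [Measure.bind_apply hA.compl (stepKernel T _ t).aemeasurable, lintegral_eq_zero_iff']
    · refine Filter.Eventually.of_forall fun y => ?_
      unfold stepKernel
      beta_reduce
      rw [Kernel.compProd_apply hA.compl]
      simp [Policy.stationary, Kernel.deterministic_apply]
    · exact (Kernel.measurable_coe _ hA.compl).aemeasurable

end Marginals

/-! ### Performance difference and verification bounds, discounted cost -/

section PerformanceDifference

variable {S U : Type*} [MeasurableSpace S] [MeasurableSpace U]

lemma integrable_of_abs_le {α : Type*} [MeasurableSpace α] {μ : Measure α} [IsFiniteMeasure μ]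
    {f : α → ℝ} (hf : Measurable f) {b : ℝ} (hb : ∀ a, |f a| ≤ b) : Integrable f μ :=
  Integrable.of_bound hf.aestronglyMeasurable b (ae_of_all _ hb)

lemma abs_integral_le_of_abs_le {α : Type*} [MeasurableSpace α] {μ : Measure α}
    [IsProbabilityMeasure μ] {f : α → ℝ} {b : ℝ} (hb : ∀ a, |f a| ≤ b) : |∫ a, f a ∂μ| ≤ b := by
  simpa using norm_integral_le_of_norm_le_const (μ := μ) (f := f) (ae_of_all _ hb)

/-- The gap in the optimality inequality at the state-action pair `p`, for the candidate
(relative) value function `v` and the gain `g`. -/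
def bellmanGap (β : ℝ) (c : S → U → ℝ) (T : Kernel (S × U) S) (v : S → ℝ) (g : ℝ)
    (p : S × U) : ℝ :=
  c p.1 p.2 + β * ∫ y, v y ∂(T p) - v p.1 - g

variable (β : ℝ) {c : S → U → ℝ} (hc : Measurable (fun p : S × U => c p.1 p.2)) {K : ℝ}
  (hK : ∀ x u, |c x u| ≤ K) (T : Kernel (S × U) S) [IsMarkovKernel T] (γ : Policy S U) (x : S)
  {v : S → ℝ} (hv : Measurable v) {D : ℝ} (hD : ∀ y, |v y| ≤ D) (g : ℝ)

include hv in
lemma measurable_integral_kernel : Measurable (fun p : S × U => ∫ y, v y ∂(T p)) :=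
  (hv.stronglyMeasurable.integral_kernel (κ := T)).measurable

include hc hv in
lemma measurable_bellmanGap : Measurable (bellmanGap β c T v g) := by
  have := measurable_integral_kernel T hv
  unfold bellmanGap
  fun_prop

include hK hD in
lemma abs_bellmanGap_le (p : S × U) :
    |bellmanGap β c T v g p| ≤ K + |β| * D + D + |g| := by
  have h1 : |β * ∫ y, v y ∂(T p)| ≤ |β| * D := by
    rw [abs_mul]
    exact mul_le_mul_of_nonneg_left (abs_integral_le_of_abs_le hD) (abs_nonneg _)
  unfold bellmanGap
  have := hK p.1 p.2
  have := hD p.1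
  simp only [abs_le] at *
  have := neg_abs_le g
  have := le_abs_self g
  constructor <;> linarith

include hv hD in
lemma integral_fst_stateActionLaw_succ (t : ℕ) :
    ∫ p, v p.1 ∂(stateActionLaw T γ x (t + 1)) =
      ∫ p, ∫ y, v y ∂(T p) ∂(stateActionLaw T γ x t) := by
  rw [← integral_map (f := v) measurable_fst.aemeasurable hv.aestronglyMeasurable,
    fst_stateActionLaw_succ]
  have h : T ∘ₘ stateActionLaw T γ x t =
      (T ∘ₖ Kernel.const Unit (stateActionLaw T γ x t)) () := by
    rw [Kernel.comp_apply, Kernel.const_apply]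
  rw [h, Kernel.integral_comp, Kernel.const_apply]
  rw [← h]
  rw [← fst_stateActionLaw_succ]
  have : IsProbabilityMeasure ((stateActionLaw T γ x (t + 1)).map Prod.fst) :=
    Measure.isProbabilityMeasure_map measurable_fst.aemeasurable
  exact integrable_of_abs_le hv hD

include hv in
lemma integral_fst_stateActionLaw_zero :
    ∫ p, v p.1 ∂(stateActionLaw T γ x 0) = v x := by
  rw [← integral_map (f := v) measurable_fst.aemeasurable hv.aestronglyMeasurable,
    fst_stateActionLaw_zero]
  exact integral_dirac' _ _ hv.stronglyMeasurable

include hc hK hv hD in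
-- Integrating the gap turns the kernel term into the expectation of `v` at time `t + 1`, so that
-- sums over `t` telescope.
lemma integral_bellmanGap (t : ℕ) :
    ∫ p, bellmanGap β c T v g p ∂(stateActionLaw T γ x t) =
      ∫ p, c p.1 p.2 ∂(stateActionLaw T γ x t) +
        β * ∫ p, v p.1 ∂(stateActionLaw T γ x (t + 1)) -
        ∫ p, v p.1 ∂(stateActionLaw T γ x t) - g := by
  have i1 : Integrable (fun p : S × U => c p.1 p.2) (stateActionLaw T γ x t) :=
    integrable_of_abs_le hc fun p => hK p.1 p.2
  have i2 : Integrable (fun p : S × U => ∫ y, v y ∂(T p)) (stateActionLaw T γ x t) :=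
    integrable_of_abs_le (measurable_integral_kernel T hv) fun p => abs_integral_le_of_abs_le hD
  have i3 : Integrable (fun p : S × U => v p.1) (stateActionLaw T γ x t) :=
    integrable_of_abs_le (hv.comp measurable_fst) fun p => hD p.1
  unfold bellmanGap
  rw [integral_sub (f := fun p : S × U => c p.1 p.2 + β * ∫ y, v y ∂(T p) - v p.1)
      ((i1.add (i2.const_mul β)).sub i3) (integrable_const _),
    integral_sub (f := fun p : S × U => c p.1 p.2 + β * ∫ y, v y ∂(T p)) (i1.add (i2.const_mul β)) i3,
    integral_add i1 (i2.const_mul β),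
    integral_const_mul, integral_fst_stateActionLaw_succ T γ x hv hD]
  simp

lemma abs_pow_mul_le {β a b : ℝ} (hβ : 0 ≤ β) (t : ℕ) (h : |a| ≤ b) :
    |β ^ t * a| ≤ b * β ^ t := by
  rw [abs_mul, abs_of_nonneg (pow_nonneg hβ t), mul_comm]
  exact mul_le_mul_of_nonneg_right h (pow_nonneg hβ t)

lemma summable_pow_mul {β : ℝ} (hβ : 0 ≤ β) (hβ1 : β < 1) {a : ℕ → ℝ} {b : ℝ}
    (h : ∀ t, |a t| ≤ b) : Summable (fun t => β ^ t * a t) :=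
  Summable.of_norm_bounded ((summable_geometric_of_lt_one hβ hβ1).mul_left b)
    fun t => abs_pow_mul_le hβ t (h t)

variable {β}

include hc hK in
lemma discountedCost_eq_tsum (hβ : 0 ≤ β) (hβ1 : β < 1) :
    discountedCost β c T γ x = ∑' t, β ^ t * ∫ p, c p.1 p.2 ∂(stateActionLaw T γ x t) := by
  have hm (t : ℕ) : Measurable (fun ω : ℕ → S × U => c (ω t).1 (ω t).2) :=
    hc.comp (measurable_pi_apply t)
  have hi (t : ℕ) : Integrable (fun ω : ℕ → S × U => β ^ t * c (ω t).1 (ω t).2)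
      (pathLaw T γ x) :=
    (integrable_of_abs_le (hm t) fun ω => hK _ _).const_mul _
  unfold discountedCost
  rw [← integral_tsum_of_summable_integral_norm hi]
  · refine tsum_congr fun t => ?_
    rw [integral_const_mul, stateActionLaw,
      integral_map (measurable_pi_apply t).aemeasurable hc.aestronglyMeasurable]
  · refine Summable.of_norm_bounded ((summable_geometric_of_lt_one hβ hβ1).mul_left K) fun t => ?_
    refine norm_integral_le_of_norm_le_const (μ := pathLaw T γ x) (C := K * β ^ t)
      (ae_of_all _ fun ω => ?_) |>.trans (by simp)
    rw [norm_norm]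
    exact abs_pow_mul_le hβ t (hK _ _)

include hc hK hv hD in
/-- The performance difference formula for the discounted cost. -/
lemma discountedCost_eq_add_tsum_bellmanGap (hβ : 0 ≤ β) (hβ1 : β < 1) :
    discountedCost β c T γ x =
      v x + ∑' t, β ^ t * ∫ p, bellmanGap β c T v 0 p ∂(stateActionLaw T γ x t) := by
  set a : ℕ → ℝ := fun t => ∫ p, v p.1 ∂(stateActionLaw T γ x t) with ha
  have ha0 : a 0 = v x := integral_fst_stateActionLaw_zero T γ x hv
  have hab (t) : |a t| ≤ D := abs_integral_le_of_abs_le fun p => hD p.1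
  have hs := summable_pow_mul hβ hβ1 hab
  have hs1 : Summable fun t => β ^ (t + 1) * a (t + 1) :=
    (summable_nat_add_iff (f := fun t => β ^ t * a t) 1).2 hs
  have hcs : Summable fun t => β ^ t * ∫ p, c p.1 p.2 ∂(stateActionLaw T γ x t) :=
    summable_pow_mul hβ hβ1 fun t => abs_integral_le_of_abs_le fun p => hK _ _
  rw [discountedCost_eq_tsum hc hK T γ x hβ hβ1]
  have h (t : ℕ) : β ^ t * ∫ p, bellmanGap β c T v 0 p ∂(stateActionLaw T γ x t) =
      β ^ t * ∫ p, c p.1 p.2 ∂(stateActionLaw T γ x t) + β ^ (t + 1) * a (t + 1) -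
        β ^ t * a t := by
    rw [integral_bellmanGap β hc hK T γ x hv hD 0 t]
    simp only [ha]
    ring
  rw [tsum_congr h, (hcs.add hs1).tsum_sub hs, hcs.tsum_add hs1, hs.tsum_eq_zero_add]
  simp only [pow_zero, one_mul, ha0]
  ring

include hc hK hv hD in
lemma le_discountedCost (hβ : 0 ≤ β) (hβ1 : β < 1) (h : ∀ p, 0 ≤ bellmanGap β c T v 0 p) :
    v x ≤ discountedCost β c T γ x := by
  rw [discountedCost_eq_add_tsum_bellmanGap hc hK T γ x hv hD hβ hβ1]
  have : 0 ≤ ∑' t, β ^ t * ∫ p, bellmanGap β c T v 0 p ∂(stateActionLaw T γ x t) :=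
    tsum_nonneg fun t => mul_nonneg (pow_nonneg hβ t) (integral_nonneg h)
  linarith

variable [Countable U] [MeasurableSingletonClass U]

lemma integral_stateActionLaw_stationary (f : S → U) (hf : Measurable f) (t : ℕ)
    (φ : S × U → ℝ) :
    ∫ p, φ p ∂(stateActionLaw T (Policy.stationary f hf) x t) =
      ∫ p, φ (p.1, f p.1) ∂(stateActionLaw T (Policy.stationary f hf) x t) := by
  refine integral_congr_ae ?_
  filter_upwards [ae_stateActionLaw_stationary T x f hf t] with p hp
  rw [← hp]

include hc hK hv hD in
lemma discountedCost_stationary_le (hβ : 0 ≤ β) (hβ1 : β < 1) (f : S → U) (hf : Measurable f)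
    {e : ℝ} (h : ∀ y, bellmanGap β c T v 0 (y, f y) ≤ e) :
    discountedCost β c T (Policy.stationary f hf) x ≤ v x + e / (1 - β) := by
  rw [discountedCost_eq_add_tsum_bellmanGap hc hK T _ x hv hD hβ hβ1]
  have hm := measurable_bellmanGap β hc T hv 0
  have hb := abs_bellmanGap_le β hK T hD 0
  refine add_le_add_right ?_ _
  rw [div_eq_mul_inv, ← tsum_geometric_of_lt_one hβ hβ1, ← tsum_mul_left]
  refine Summable.tsum_le_tsum (fun t => ?_)
    (summable_pow_mul hβ hβ1 fun t => abs_integral_le_of_abs_le hb)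
    ((summable_geometric_of_lt_one hβ hβ1).mul_left e)
  rw [integral_stateActionLaw_stationary, mul_comm]
  refine mul_le_mul_of_nonneg_right ?_ (pow_nonneg hβ t)
  calc _ ≤ ∫ p, e ∂(stateActionLaw T (Policy.stationary f hf) x t) :=
        integral_mono (integrable_of_abs_le (hm.comp (by fun_prop)) fun p => hb _)
          (integrable_const _) fun p => h p.1
    _ = e := by simp

include hc hK hv hD in
-- Every term of the performance difference series is nonnegative, so the term at time 0, which is
-- the gap at the initial state, is at most the whole loss. Hence an optimal stationary policy is
-- greedy.
lemma bellmanGap_stationary_le (hβ : 0 ≤ β) (hβ1 : β < 1)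
    (h : ∀ p, 0 ≤ bellmanGap β c T v 0 p) (f : S → U) (hf : Measurable f) :
    bellmanGap β c T v 0 (x, f x) ≤
      discountedCost β c T (Policy.stationary f hf) x - v x := by
  rw [discountedCost_eq_add_tsum_bellmanGap hc hK T _ x hv hD hβ hβ1]
  have hm := measurable_bellmanGap β hc T hv 0
  have hb := abs_bellmanGap_le β hK T hD 0
  have := (summable_pow_mul hβ hβ1 fun t => abs_integral_le_of_abs_le
    (μ := stateActionLaw T (Policy.stationary f hf) x t) hb).le_tsum 0
    fun t _ => mul_nonneg (pow_nonneg hβ t) (integral_nonneg h)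
  rw [integral_stateActionLaw_stationary,
    integral_fst_stateActionLaw_zero T _ x (v := fun y => bellmanGap β c T v 0 (y, f y))] at this
  · simp only [pow_zero, one_mul] at this
    linarith
  · exact hm.comp (by fun_prop)

end PerformanceDifference

/-! ### Average cost bounds and verification theorems -/

section OptimalCost

variable {S U : Type*} [MeasurableSpace S] [MeasurableSpace U]

variable {c : S → U → ℝ} (hc : Measurable (fun p : S × U => c p.1 p.2)) {K : ℝ}
  (hK : ∀ x u, |c x u| ≤ K) (T : Kernel (S × U) S) [IsMarkovKernel T] (γ : Policy S U) (x : S)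
  {v : S → ℝ} (hv : Measurable v) {D : ℝ} (hD : ∀ y, |v y| ≤ D) (g : ℝ)

/-- The expected cost per stage over the first `n` stages. -/
def meanCost (c : S → U → ℝ) (n : ℕ) : ℝ :=
  (1 / (n : ℝ)) * ∫ ω, ∑ t ∈ Finset.range n, c (ω t).1 (ω t).2 ∂(pathLaw T γ x)

include hc hK in
lemma meanCost_eq_sum (n : ℕ) :
    meanCost T γ x c n =
      (1 / (n : ℝ)) * ∑ t ∈ Finset.range n, ∫ p, c p.1 p.2 ∂(stateActionLaw T γ x t) := by
  have hm (t : ℕ) : Measurable (fun ω : ℕ → S × U => c (ω t).1 (ω t).2) :=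
    hc.comp (measurable_pi_apply t)
  unfold meanCost
  rw [integral_finsetSum _ fun t _ => integrable_of_abs_le (hm t) fun ω => hK _ _]
  congr 1
  refine Finset.sum_congr rfl fun t _ => ?_
  rw [stateActionLaw, integral_map (measurable_pi_apply t).aemeasurable hc.aestronglyMeasurable]

include hc hK hv hD in
/-- The performance difference formula for the average cost. -/
lemma meanCost_eq_add_sum_bellmanGap {n : ℕ} (hn : n ≠ 0) :
    meanCost T γ x c n = g + (v x - ∫ p, v p.1 ∂(stateActionLaw T γ x n)) / n +
      (∑ t ∈ Finset.range n, ∫ p, bellmanGap 1 c T v g p ∂(stateActionLaw T γ x t)) / n := by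
  rw [meanCost_eq_sum hc hK T γ x, ← integral_fst_stateActionLaw_zero T γ x hv]
  have hn' : (n : ℝ) ≠ 0 := Nat.cast_ne_zero.2 hn
  have h := Finset.sum_range_sub' (fun t => ∫ p, v p.1 ∂(stateActionLaw T γ x t)) n
  rw [← h, Finset.sum_congr rfl fun t _ => integral_bellmanGap 1 hc hK T γ x hv hD g t]
  simp only [Finset.sum_sub_distrib, Finset.sum_add_distrib, Finset.sum_const, one_mul,
    Finset.card_range, nsmul_eq_mul]
  field_simp
  ring

include hc hK in
lemma abs_meanCost_le (n : ℕ) : |meanCost T γ x c n| ≤ K := by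
  have hK0 : 0 ≤ K := (abs_nonneg _).trans
    (abs_integral_le_of_abs_le (μ := stateActionLaw T γ x 0) fun p => hK p.1 p.2)
  -- For `n = 0` the mean cost is 0, because `1 / 0 = 0`.
  rcases eq_or_ne n 0 with rfl | hn
  · simpa [meanCost] using hK0
  · rw [meanCost_eq_sum hc hK T γ x, abs_mul, abs_of_nonneg (by positivity), one_div,
      inv_mul_le_iff₀ (by positivity)]
    refine (Finset.abs_sum_le_sum_abs _ _).trans ?_
    refine (Finset.sum_le_sum fun t _ => abs_integral_le_of_abs_le fun p => hK p.1 p.2).trans ?_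
    simp

include hc hK in
-- Boundedness is needed wherever real `limsup`s are compared, as an unbounded sequence gets a
-- default value.
lemma isBoundedUnder_meanCost : IsBoundedUnder (· ≤ ·) atTop (meanCost T γ x c) :=
  isBoundedUnder_of ⟨K, fun n => (abs_le.1 (abs_meanCost_le hc hK T γ x n)).2⟩

include hc hK in
lemma isBoundedUnder_ge_meanCost : IsBoundedUnder (· ≥ ·) atTop (meanCost T γ x c) :=
  isBoundedUnder_of ⟨-K, fun n => (abs_le.1 (abs_meanCost_le hc hK T γ x n)).1⟩

lemma averageCost_eq_limsup : averageCost c T γ x = limsup (meanCost T γ x c) atTop := rfl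

include hc hK in
lemma averageCost_le : averageCost c T γ x ≤ K := by
  rw [averageCost_eq_limsup]
  exact limsup_le_of_le (isBoundedUnder_ge_meanCost hc hK T γ x).isCoboundedUnder_le
    (Eventually.of_forall fun n => (abs_le.1 (abs_meanCost_le hc hK T γ x n)).2)

include hc hK in
lemma le_averageCost_of_tendsto {a : ℕ → ℝ} {l : ℝ} (ha : Tendsto a atTop (nhds l))
    (h : ∀ᶠ n in atTop, a n ≤ meanCost T γ x c n) : l ≤ averageCost c T γ x := by
  rw [averageCost_eq_limsup, ← ha.limsup_eq]
  exact limsup_le_limsup h ha.isBoundedUnder_ge.isCoboundedUnder_le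
    (isBoundedUnder_meanCost hc hK T γ x)

include hc hK in
lemma averageCost_le_of_tendsto {a : ℕ → ℝ} {l : ℝ} (ha : Tendsto a atTop (nhds l))
    (h : ∀ᶠ n in atTop, meanCost T γ x c n ≤ a n) : averageCost c T γ x ≤ l := by
  rw [averageCost_eq_limsup, ← ha.limsup_eq]
  exact limsup_le_limsup h (isBoundedUnder_ge_meanCost hc hK T γ x).isCoboundedUnder_le
    ha.isBoundedUnder_le

include hc hK in
lemma averageCost_nonneg (h0 : ∀ x u, 0 ≤ c x u) : 0 ≤ averageCost c T γ x := by
  refine le_averageCost_of_tendsto hc hK T γ x tendsto_const_nhds (Eventually.of_forall fun n => ?_)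
  rw [meanCost_eq_sum hc hK T γ x]
  exact mul_nonneg (by positivity)
    (Finset.sum_nonneg fun t _ => integral_nonneg fun p => h0 p.1 p.2)

include hD in
lemma tendsto_relativeValue_div :
    Tendsto (fun n : ℕ => (v x - ∫ p, v p.1 ∂(stateActionLaw T γ x n)) / n) atTop (nhds 0) := by
  refine squeeze_zero_norm (a := fun n : ℕ => (2 * D) / n) (fun n => ?_)
    (tendsto_const_div_atTop_nhds_zero_nat _)
  rw [Real.norm_eq_abs, abs_div, Nat.abs_cast]
  refine div_le_div_of_nonneg_right ?_ (Nat.cast_nonneg n)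
  have h1 := hD x
  have h2 := abs_integral_le_of_abs_le (μ := stateActionLaw T γ x n) fun p => hD p.1
  rw [abs_le] at *
  constructor <;> linarith

include hc hK hv hD in
-- The boundary term of the telescoping sum is bounded by `2 * D / n` and disappears in the limit;
-- only the gain and the averaged gaps remain.
lemma le_averageCost (h : ∀ p, 0 ≤ bellmanGap 1 c T v g p) : g ≤ averageCost c T γ x := by
  have ht := (tendsto_relativeValue_div T γ x hD).const_add g
  rw [add_zero] at ht
  refine le_averageCost_of_tendsto hc hK T γ x ht ?_
  filter_upwards [eventually_ne_atTop 0] with n hn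
  rw [meanCost_eq_add_sum_bellmanGap hc hK T γ x hv hD g hn]
  have : 0 ≤ (∑ t ∈ Finset.range n,
      ∫ p, bellmanGap 1 c T v g p ∂(stateActionLaw T γ x t)) / n :=
    div_nonneg (Finset.sum_nonneg fun t _ => integral_nonneg h) (Nat.cast_nonneg n)
  linarith

variable [Countable U] [MeasurableSingletonClass U]

include hc hK hv hD in
lemma averageCost_stationary_le (f : S → U) (hf : Measurable f) {e : ℝ}
    (h : ∀ y, bellmanGap 1 c T v g (y, f y) ≤ e) :
    averageCost c T (Policy.stationary f hf) x ≤ g + e := by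
  have ht := ((tendsto_relativeValue_div T (Policy.stationary f hf) x hD).const_add g).add_const e
  rw [add_zero] at ht
  refine averageCost_le_of_tendsto hc hK T _ x ht ?_
  filter_upwards [eventually_ne_atTop 0] with n hn
  rw [meanCost_eq_add_sum_bellmanGap hc hK T _ x hv hD g hn]
  have hm := measurable_bellmanGap 1 hc T hv g
  have hb := abs_bellmanGap_le 1 hK T hD g
  refine add_le_add_right ?_ _
  have hn' : 0 < (n : ℝ) := Nat.cast_pos.2 (Nat.pos_of_ne_zero hn)
  rw [div_le_iff₀ hn']
  calc _ ≤ ∑ t ∈ Finset.range n, e := by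
        refine Finset.sum_le_sum fun t _ => ?_
        rw [integral_stateActionLaw_stationary]
        calc _ ≤ ∫ p, e ∂(stateActionLaw T (Policy.stationary f hf) x t) :=
              integral_mono (integrable_of_abs_le (hm.comp (by fun_prop)) fun p => hb _)
                (integrable_const _) fun p => h p.1
          _ = e := by simp
    _ = e * n := by simp [mul_comm]

/-- With countably many actions, choosing the first admissible one in an enumeration is measurable.
-/
lemma exists_measurable_selection [Nonempty U] {φ : S × U → ℝ} (hφ : Measurable φ)
    (h : ∀ y, ∃ u, φ (y, u) ≤ 0) : ∃ f : S → U, Measurable f ∧ ∀ y, φ (y, f y) ≤ 0 := by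
  classical
  obtain ⟨e, he⟩ := exists_surjective_nat U
  have h' (y : S) : ∃ n, φ (y, e n) ≤ 0 := by
    obtain ⟨u, hu⟩ := h y
    obtain ⟨n, rfl⟩ := he u
    exact ⟨n, hu⟩
  refine ⟨fun y => e (Nat.find (h' y)), Measurable.of_discrete.comp (measurable_find h' fun n => ?_),
    fun y => Nat.find_spec (h' y)⟩
  exact measurableSet_le (hφ.comp (by fun_prop)) measurable_const

include hc hK hv hD in
/-- Verification theorem for the discounted cost. -/
lemma optDiscountedCost_eq [Nonempty U] {β : ℝ} (hβ : 0 ≤ β) (hβ1 : β < 1)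
    (h : ∀ p, 0 ≤ bellmanGap β c T v 0 p) (h' : ∀ y, ∃ u, bellmanGap β c T v 0 (y, u) ≤ 0) :
    optDiscountedCost β c T x = v x := by
  obtain ⟨f, hf, hf'⟩ := exists_measurable_selection (measurable_bellmanGap β hc T hv 0) h'
  have hle (γ : Policy S U) := le_discountedCost hc hK T γ x hv hD hβ hβ1 h
  refine le_antisymm ?_ ?_
  · refine (ciInf_le ⟨v x, ?_⟩ (Policy.stationary f hf)).trans ?_
    · rintro _ ⟨γ, rfl⟩
      exact hle γ
    · simpa using discountedCost_stationary_le hc hK T x hv hD hβ hβ1 f hf hf'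
  · have : Nonempty (Policy S U) := ⟨Policy.stationary f hf⟩
    exact le_ciInf hle

include hc hK hv hD in
/-- Verification theorem for the average cost. -/
lemma optAverageCost_eq [Nonempty U]
    (h : ∀ p, 0 ≤ bellmanGap 1 c T v g p) (h' : ∀ y, ∃ u, bellmanGap 1 c T v g (y, u) ≤ 0) :
    optAverageCost c T x = g := by
  obtain ⟨f, hf, hf'⟩ := exists_measurable_selection (measurable_bellmanGap 1 hc T hv g) h'
  have hle (γ : Policy S U) := le_averageCost hc hK T γ x hv hD g h
  refine le_antisymm ?_ ?_
  · refine (ciInf_le ⟨g, ?_⟩ (Policy.stationary f hf)).trans ?_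
    · rintro _ ⟨γ, rfl⟩
      exact hle γ
    · simpa using averageCost_stationary_le hc hK T x hv hD g f hf hf'
  · have : Nonempty (Policy S U) := ⟨Policy.stationary f hf⟩
    exact le_ciInf hle

end OptimalCost

/-- This transfers contraction, Lipschitz and comparison bounds from each fixed action to the
minimum over actions. -/
lemma abs_inf'_sub_inf'_le {ι : Type*} {s : Finset ι} (hs : s.Nonempty) {f g : ι → ℝ} {e : ℝ}
    (h : ∀ i ∈ s, |f i - g i| ≤ e) : |s.inf' hs f - s.inf' hs g| ≤ e := by
  rw [abs_le, neg_le_sub_iff_le_add, sub_le_iff_le_add]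
  constructor
  · obtain ⟨i, hi, hi'⟩ := s.exists_mem_eq_inf' hs f
    have h1 := (abs_le.1 (h i hi)).1
    have h2 := s.inf'_le g hi
    linarith
  · obtain ⟨i, hi, hi'⟩ := s.exists_mem_eq_inf' hs g
    have h1 := (abs_le.1 (h i hi)).2
    have h2 := s.inf'_le f hi
    linarith

/-! ### Contraction of the Bellman operator of a sub-stochastic kernel -/

section FixedPoint

open BoundedContinuousFunction

variable {S U : Type*} [MeasurableSpace S] [MeasurableSpace U]

/-- If `η • ρ ≤ β • μ`, then the functional `f ↦ β ∫ f dμ - η ∫ f dρ` has norm `β - η`. -/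
lemma abs_mul_integral_sub_mul_integral_le {μ ρ : Measure S} [IsProbabilityMeasure μ]
    [IsProbabilityMeasure ρ] {β η : ℝ} (hβ : 0 ≤ β) (hη : 0 ≤ η)
    (h : ENNReal.ofReal η • ρ ≤ ENNReal.ofReal β • μ) {f : S → ℝ} (hf : Measurable f) {D : ℝ}
    (hD : ∀ x, |f x| ≤ D) : |β * ∫ x, f x ∂μ - η * ∫ x, f x ∂ρ| ≤ (β - η) * D := by
  have key (k : S → ℝ) (hk : Measurable k) (hkD : ∀ x, |k x| ≤ D) :
      β * ∫ x, k x ∂μ - η * ∫ x, k x ∂ρ ≤ (β - η) * D := by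
    have hi (ν : Measure S) [IsProbabilityMeasure ν] : Integrable k ν :=
      integrable_of_abs_le hk hkD
    have hs : Integrable (fun x => D - k x) (ENNReal.ofReal β • μ) :=
      ((integrable_const D).sub (hi μ)).smul_measure ENNReal.ofReal_ne_top
    -- The inequality of measures is tested on the nonnegative function `D - k`; the two signs of
    -- `f` then give both bounds.
    have := integral_mono_measure h (ae_of_all _ fun x => by
      have := (abs_le.1 (hkD x)).2
      simp only [Pi.zero_apply]
      linarith) hs
    rw [integral_smul_measure, integral_smul_measure, integral_sub (integrable_const D) (hi μ),
      integral_sub (integrable_const D) (hi ρ), ENNReal.toReal_ofReal hβ,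
      ENNReal.toReal_ofReal hη] at this
    simp only [integral_const, probReal_univ, smul_eq_mul, one_mul] at this
    linarith
  rw [abs_le]
  refine ⟨?_, key f hf hD⟩
  have := key (fun x => - f x) hf.neg fun x => by rw [abs_neg]; exact hD x
  rw [integral_neg, integral_neg] at this
  linarith

/-- The state-action values of the value function `v`, for the sub-stochastic kernel
`β • T - η • ρ`. -/
def qValue (β η : ℝ) (c : S → U → ℝ) (T : Kernel (S × U) S) (ρ : Measure S) (v : S → ℝ) (x : S)
    (u : U) : ℝ :=
  c x u + β * ∫ y, v y ∂(T (x, u)) - η * ∫ y, v y ∂ρ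

lemma bellmanGap_eq_qValue_sub (β η : ℝ) (c : S → U → ℝ) (T : Kernel (S × U) S) (ρ : Measure S)
    (v : S → ℝ) (x : S) (u : U) :
    bellmanGap β c T v (η * ∫ y, v y ∂ρ) (x, u) = qValue β η c T ρ v x u - v x := by
  unfold bellmanGap qValue
  ring

lemma bellmanGap_zero_eq_qValue_sub (β : ℝ) (c : S → U → ℝ) (T : Kernel (S × U) S)
    (ρ : Measure S) (v : S → ℝ) (x : S) (u : U) :
    bellmanGap β c T v 0 (x, u) = qValue β 0 c T ρ v x u - v x := by
  simpa using bellmanGap_eq_qValue_sub β 0 c T ρ v x u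

variable {β η : ℝ} {c : S → U → ℝ} {T : Kernel (S × U) S} [IsMarkovKernel T] {ρ : Measure S}
  [IsProbabilityMeasure ρ]

/-- The cost cancels, and `β • T - η • ρ` is a nonnegative kernel of mass `β - η`, which is the
contraction modulus. -/
lemma abs_qValue_sub_le (hβ : 0 ≤ β) (hη : 0 ≤ η)
    (hmin : ∀ p, ENNReal.ofReal η • ρ ≤ ENNReal.ofReal β • T p) {v w : S → ℝ}
    (hv : Measurable v) (hw : Measurable w) {B : ℝ} (hvB : ∀ x, |v x| ≤ B) (hwB : ∀ x, |w x| ≤ B)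
    {D : ℝ} (hD : ∀ x, |v x - w x| ≤ D) (x : S) (u : U) :
    |qValue β η c T ρ v x u - qValue β η c T ρ w x u| ≤ (β - η) * D := by
  have h := abs_mul_integral_sub_mul_integral_le hβ hη (hmin (x, u)) (hv.sub hw) hD
  rw [integral_sub' (integrable_of_abs_le hv hvB) (integrable_of_abs_le hw hwB),
    integral_sub' (integrable_of_abs_le hv hvB) (integrable_of_abs_le hw hwB)] at h
  convert h using 2
  unfold qValue
  ring

variable [TopologicalSpace S] [OpensMeasurableSpace S] [Fintype U] [Nonempty U]

/-- The Bellman operator has a fixed point in every closed invariant set of bounded continuous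
functions that contains `0`. -/
theorem exists_bellman_fixedPoint (hβ : 0 ≤ β) (hη : 0 ≤ η) (hβη : β - η < 1)
    (hmin : ∀ p, ENNReal.ofReal η • ρ ≤ ENNReal.ofReal β • T p) {K : ℝ}
    (hK : ∀ x u, |c x u| ≤ K) (hc : ∀ u, Continuous fun x => c x u)
    (hT : ∀ (v : S →ᵇ ℝ) u, Continuous fun x => ∫ y, v y ∂(T (x, u)))
    (A : Set (S →ᵇ ℝ)) (hA : IsClosed A) (hA0 : 0 ∈ A)
    (hAinv : ∀ v ∈ A, ∀ w : S →ᵇ ℝ,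
      (∀ x, w x = Finset.univ.inf' Finset.univ_nonempty (qValue β η c T ρ v x)) → w ∈ A) :
    ∃ v ∈ A, (∀ x, v x = Finset.univ.inf' Finset.univ_nonempty (qValue β η c T ρ v x)) ∧
      ∀ x, |v x| ≤ K / (1 - (β - η)) := by
  have hm (v : S →ᵇ ℝ) : Measurable v := v.continuous.measurable
  rcases isEmpty_or_nonempty S with hS | ⟨⟨x₀⟩⟩
  · exact ⟨0, hA0, fun x => hS.elim x, fun x => hS.elim x⟩
  -- Comparison of total masses in the minorization.
  have hle : 0 ≤ β - η := by
    obtain ⟨u⟩ := ‹Nonempty U›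
    have := hmin (x₀, u) Set.univ
    simp only [Measure.smul_apply, measure_univ, smul_eq_mul, mul_one] at this
    linarith [(ENNReal.ofReal_le_ofReal_iff hβ).1 this]
  have hcontr (v w : S →ᵇ ℝ) (x : S) (u : U) :
      |qValue β η c T ρ v x u - qValue β η c T ρ w x u| ≤ (β - η) * dist v w := by
    have hB : ∀ y, |v y| ≤ max ‖v‖ ‖w‖ := fun y => (v.norm_coe_le_norm y).trans (le_max_left _ _)
    have hB' : ∀ y, |w y| ≤ max ‖v‖ ‖w‖ := fun y => (w.norm_coe_le_norm y).trans (le_max_right _ _)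
    exact abs_qValue_sub_le hβ hη hmin (hm v) (hm w) hB hB' 
      (fun y => by rw [← Real.dist_eq]; exact dist_coe_le_dist y) x u
  have hq0 (x u) : qValue β η c T ρ (0 : S →ᵇ ℝ) x u = c x u := by simp [qValue]
  let F (v : S →ᵇ ℝ) : S →ᵇ ℝ := BoundedContinuousFunction.ofNormedAddCommGroup
    (fun x => Finset.univ.inf' Finset.univ_nonempty (qValue β η c T ρ v x))
    (Continuous.finset_inf'_apply _ fun u _ =>
      ((hc u).add ((hT v u).const_mul β)).sub continuous_const)
    (K + (β - η) * dist v 0) (fun x => by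
      obtain ⟨u, -, hu⟩ := Finset.univ.exists_mem_eq_inf' Finset.univ_nonempty
        (qValue β η c T ρ v x)
      rw [hu, Real.norm_eq_abs]
      have h1 := hcontr v 0 x u
      rw [hq0] at h1
      have h2 := hK x u
      have h3 := abs_sub_abs_le_abs_sub (qValue β η c T ρ v x u) (c x u)
      linarith)
  have hF (v : S →ᵇ ℝ) (x : S) :
      F v x = Finset.univ.inf' Finset.univ_nonempty (qValue β η c T ρ v x) := rfl
  have hFdist (v w : S →ᵇ ℝ) : dist (F v) (F w) ≤ (β - η) * dist v w := by
    refine (BoundedContinuousFunction.dist_le (mul_nonneg hle dist_nonneg)).2 fun x => ?_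
    rw [Real.dist_eq, hF, hF]
    exact abs_inf'_sub_inf'_le _ fun u _ => hcontr v w x u
  have hC : ContractingWith (β - η).toNNReal F := by
    refine ⟨by rw [← NNReal.coe_lt_coe, Real.coe_toNNReal _ hle]; simpa using hβη,
      LipschitzWith.of_dist_le_mul fun v w => ?_⟩
    rw [Real.coe_toNNReal _ hle]
    exact hFdist v w
  have hmaps : Set.MapsTo F A A := fun v hv => hAinv v hv _ (hF v)
  -- Banach's theorem on the complete set `A`, started at `0 ∈ A`: the fixed point inherits every
  -- closed property that the operator preserves.
  obtain ⟨v, hvA, hv, -, -⟩ := ContractingWith.exists_fixedPoint' hA.isComplete hmaps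
    (hC.restrict hmaps) hA0 (edist_ne_top _ _)
  have hfix : F v = v := hv
  refine ⟨v, hvA, fun x => by rw [← hF, hfix], fun x => ?_⟩
  have h1 : dist v 0 ≤ (β - η) * dist v 0 + K := by
    calc dist v 0 = dist (F v) 0 := by rw [hfix]
      _ ≤ dist (F v) (F 0) + dist (F 0) 0 := dist_triangle _ _ _
      _ ≤ (β - η) * dist v 0 + K := by
        refine add_le_add (hFdist v 0) ?_
        have hK0 : 0 ≤ K := (abs_nonneg _).trans (hK x₀ (Classical.arbitrary U))
        refine (BoundedContinuousFunction.dist_le hK0).2 fun y => ?_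
        obtain ⟨u, -, hu⟩ := Finset.univ.exists_mem_eq_inf' Finset.univ_nonempty
          (qValue β η c T ρ (0 : S →ᵇ ℝ) y)
        rw [hF, hu, hq0]
        simpa using hK y u
  have h2 : |v x| ≤ dist v 0 := by
    rw [dist_zero_right]
    exact v.norm_coe_le_norm x
  rw [le_div_iff₀ (by linarith)]
  nlinarith

end FixedPoint

/-! ### Lipschitz value functions in Wasserstein regular models -/

section Wasserstein

variable {X U : Type*} [MetricSpace X] [SecondCountableTopology X] [MeasurableSpace X]
  [BorelSpace X]

/-- The easy half of Kantorovich duality: integrate `v p.1 - v p.2` against a coupling. A nearly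
optimal coupling is enough, so the bound is first proved with a slack `ε`. -/
lemma abs_integral_sub_integral_le_of_wasserstein1_le {μ ν : Measure X} [IsProbabilityMeasure μ]
    [IsProbabilityMeasure ν] {r : ℝ} (hr : 0 ≤ r) (h : wasserstein1 μ ν ≤ ENNReal.ofReal r)
    {v : X → ℝ} (hv : Measurable v) {D : ℝ} (hD : ∀ x, |v x| ≤ D) {L : ℝ} (hL : 0 ≤ L)
    (hvL : ∀ x y, |v x - v y| ≤ L * dist x y) : |∫ x, v x ∂μ - ∫ x, v x ∂ν| ≤ L * r := by
  have key (ε : ℝ) (hε : 0 < ε) : |∫ x, v x ∂μ - ∫ x, v x ∂ν| ≤ L * (r + ε) := by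
    have hlt : wasserstein1 μ ν < ENNReal.ofReal (r + ε) :=
      h.trans_lt ((ENNReal.ofReal_lt_ofReal_iff (by linarith)).2 (by linarith))
    unfold wasserstein1 at hlt
    obtain ⟨θ, hθ⟩ := iInf_lt_iff.1 hlt
    obtain ⟨⟨h1, h2⟩, hθ⟩ := iInf_lt_iff.1 hθ
    have : IsProbabilityMeasure θ := ⟨by
      rw [← Set.preimage_univ (f := Prod.fst), ← Measure.map_apply measurable_fst .univ, h1,
        measure_univ]⟩
    rw [← h1, ← h2, integral_map measurable_fst.aemeasurable hv.aestronglyMeasurable,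
      integral_map measurable_snd.aemeasurable hv.aestronglyMeasurable,
      ← integral_sub (f := fun p : X × X => v p.1) (g := fun p : X × X => v p.2)
        (integrable_of_abs_le (hv.comp measurable_fst) fun p => hD p.1)
        (integrable_of_abs_le (hv.comp measurable_snd) fun p => hD p.2)]
    rw [← ENNReal.ofReal_le_ofReal_iff (by positivity), ← Real.enorm_eq_ofReal_abs]
    refine (enorm_integral_le_lintegral_enorm _).trans ?_
    calc ∫⁻ p, ‖v p.1 - v p.2‖ₑ ∂θ ≤ ∫⁻ p, ENNReal.ofReal L * edist p.1 p.2 ∂θ := by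
          refine lintegral_mono fun p => ?_
          rw [edist_dist, ← ENNReal.ofReal_mul hL, Real.enorm_eq_ofReal_abs]
          exact ENNReal.ofReal_le_ofReal (hvL _ _)
      _ = ENNReal.ofReal L * ∫⁻ p, edist p.1 p.2 ∂θ :=
          lintegral_const_mul' _ _ ENNReal.ofReal_ne_top
      _ ≤ ENNReal.ofReal (L * (r + ε)) := by
          rw [ENNReal.ofReal_mul hL]
          gcongr
  refine le_of_forall_pos_le_add fun ε hε => ?_
  -- Dividing by `L + 1` instead of `L` also covers `L = 0`.
  refine (key (ε / (L + 1)) (by positivity)).trans ?_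
  have : L * (ε / (L + 1)) ≤ ε := by
    rw [mul_div_assoc', div_le_iff₀ (by positivity)]
    nlinarith
  linarith

variable [MetricSpace U] [MeasurableSpace U] {c : X → U → ℝ} {T : Kernel (X × U) X}
  [IsMarkovKernel T] {K : ℝ} {Lc LT : ℝ≥0} {ρ : Measure X}

/-- One Bellman step turns the Lipschitz constant `L` into `Lc + β * LT * L`. If this is at most
`L`, the `L`-Lipschitz functions form an invariant set. -/
lemma IsWassersteinRegular.abs_mul_integral_sub_le (h : IsWassersteinRegular c T K Lc LT)
    {v : X → ℝ} (hv : Measurable v) {D : ℝ} (hD : ∀ x, |v x| ≤ D) {L : ℝ} (hL : 0 ≤ L)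
    (hvL : ∀ x y, |v x - v y| ≤ L * dist x y) {β : ℝ} (hβ : 0 ≤ β) (x y : X) (u : U) :
    |c x u + β * ∫ z, v z ∂(T (x, u)) - (c y u + β * ∫ z, v z ∂(T (y, u)))| ≤
      (Lc + β * LT * L) * dist x y := by
  have h1 := (h.cost_lipschitz u).dist_le_mul x y
  rw [Real.dist_eq] at h1
  have h2 := abs_integral_sub_integral_le_of_wasserstein1_le (μ := T (x, u)) (ν := T (y, u))
    (r := LT * dist x y) (by positivity) (by
      rw [ENNReal.ofReal_mul (by positivity), ENNReal.ofReal_coe_nnreal, ← edist_dist]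
      exact h.kernel_lipschitz u x y) hv hD hL hvL
  have h3 : |β * (∫ z, v z ∂(T (x, u)) - ∫ z, v z ∂(T (y, u)))| ≤ β * (L * (LT * dist x y)) := by
    rw [abs_mul, abs_of_nonneg hβ]
    exact mul_le_mul_of_nonneg_left h2 hβ
  calc _ = |(c x u - c y u) + β * (∫ z, v z ∂(T (x, u)) - ∫ z, v z ∂(T (y, u)))| := by ring_nf
    _ ≤ Lc * dist x y + β * (L * (LT * dist x y)) := (abs_add_le _ _).trans (add_le_add h1 h3)
    _ = _ := by ring

/-- In a Wasserstein regular model the Bellman operator has a bounded Lipschitz fixed point. -/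
theorem IsWassersteinRegular.exists_lipschitz_fixedPoint [Fintype U] [Nonempty U]
    [IsProbabilityMeasure ρ] (h : IsWassersteinRegular c T K Lc LT) {β η : ℝ} (hβ : 0 ≤ β)
    (hη : 0 ≤ η) (hβη : β - η < 1)
    (hmin : ∀ p, ENNReal.ofReal η • ρ ≤ ENNReal.ofReal β • T p) {L : ℝ} (hL : 0 ≤ L)
    (hLL : Lc + β * LT * L ≤ L) :
    ∃ v : X → ℝ, Continuous v ∧ (∀ x y, |v x - v y| ≤ L * dist x y) ∧
      (∀ x, v x = Finset.univ.inf' Finset.univ_nonempty (qValue β η c T ρ v x)) ∧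
      ∀ x, |v x| ≤ K / (1 - (β - η)) := by
  obtain ⟨v, hv1, hv2, hv3⟩ := exists_bellman_fixedPoint (c := c) hβ hη hβη hmin
    (fun x u => by rw [abs_of_nonneg (h.cost_nonneg x u)]; exact h.cost_le x u)
    (fun u => (h.cost_lipschitz u).continuous)
    (fun v u => (h.kernel_continuous v).comp (by fun_prop))
    {v : BoundedContinuousFunction X ℝ | ∀ x y, |v x - v y| ≤ L * dist x y} (by
      simp only [Set.ofPred_forall]
      refine isClosed_iInter fun x => isClosed_iInter fun y => ?_
      have hev (z : X) : Continuous fun v : BoundedContinuousFunction X ℝ => v z :=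
        continuous_eval_const z
      exact isClosed_le ((hev x).sub (hev y)).abs continuous_const)
    (fun x y => by simpa using by positivity) (fun v hv w hw x y => by
      rw [hw, hw]
      refine abs_inf'_sub_inf'_le _ fun u _ => ?_
      have h1 := h.abs_mul_integral_sub_le v.continuous.measurable
        (fun x => v.norm_coe_le_norm x) hL hv hβ x y u
      have h2 : (Lc + β * LT * L) * dist x y ≤ L * dist x y :=
        mul_le_mul_of_nonneg_right hLL dist_nonneg
      have h3 : qValue β η c T ρ v x u - qValue β η c T ρ v y u =
          c x u + β * ∫ z, v z ∂(T (x, u)) - (c y u + β * ∫ z, v z ∂(T (y, u))) := by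
        unfold qValue
        ring
      rw [h3]
      exact h1.trans h2)
  exact ⟨v, v.continuous, hv1, hv2, hv3⟩

end Wasserstein

/-! ### Greedy policies of an approximating finite model -/

section Comparison

variable {S I U : Type*} [MeasurableSpace S] [MeasurableSpace U] [MeasurableSpace I] [Finite I]
  [DiscreteMeasurableSpace I] [Fintype U] [Nonempty U] {β η : ℝ}
  {c : S → U → ℝ} {T : Kernel (S × U) S} {ρ : Measure S}
  {c' : I → U → ℝ} {T' : Kernel (I × U) I} [IsMarkovKernel T'] {ρ' : Measure I}
  [IsProbabilityMeasure ρ']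

/-- Let `w` be a fixed point of the Bellman operator of a finite model, and `v` one of the Bellman
operator of the original model. If the state-action values of `v` in the two models are `e`-close,
then a policy that is greedy for `w` is nearly greedy for `v`. -/
lemma qValue_sub_le_of_greedy (hβ : 0 ≤ β) (hη : 0 ≤ η) (hβη : β - η < 1)
    (hmin : ∀ p, ENNReal.ofReal η • ρ' ≤ ENNReal.ofReal β • T' p)
    {v : S → ℝ} (hv : ∀ x, v x = Finset.univ.inf' Finset.univ_nonempty (qValue β η c T ρ v x))
    {w : I → ℝ} (hw : ∀ i, w i = Finset.univ.inf' Finset.univ_nonempty (qValue β η c' T' ρ' w i))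
    (idx : S → I) (z : I → S) (hz : ∀ i, idx (z i) = i) {e d : ℝ}
    (he : ∀ x u, |qValue β η c' T' ρ' (fun i => v (z i)) (idx x) u - qValue β η c T ρ v x u| ≤ e)
    (hd : ∀ x, |v (z (idx x)) - v x| ≤ d)
    {f : I → U} (hf : ∀ i, qValue β η c' T' ρ' w i (f i) ≤ w i) (x : S) :
    qValue β η c T ρ v x (f (idx x)) - v x ≤ d + 2 * e / (1 - (β - η)) := by
  have : Nonempty I := ⟨idx x⟩
  have : Nonempty S := ⟨x⟩
  obtain ⟨i₀, hi₀⟩ := Finite.exists_max fun i => |w i - v (z i)|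
  obtain ⟨j₁, hj₁⟩ := Finite.exists_max fun i => |w i|
  obtain ⟨j₂, hj₂⟩ := Finite.exists_max fun i => |v (z i)|
  set D := |w i₀ - v (z i₀)|
  have hq (i u) : |qValue β η c' T' ρ' w i u - qValue β η c' T' ρ' (fun i => v (z i)) i u| ≤
      (β - η) * D :=
    abs_qValue_sub_le hβ hη hmin .of_discrete .of_discrete
      (B := max |w j₁| |v (z j₂)|) (fun i => (hj₁ i).trans (le_max_left _ _))
      (fun i => (hj₂ i).trans (le_max_right _ _)) hi₀ i u
  -- At a maximizer `i₀`, both `w` and `v` are replaced by their Bellman minima: contraction costs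
  -- `(β - η) * D`, the change of model costs `e`.
  have hD : D ≤ (β - η) * D + e := by
    change |w i₀ - v (z i₀)| ≤ _
    rw [hw, hv]
    refine abs_inf'_sub_inf'_le _ fun u _ => ?_
    have h1 := hq i₀ u
    have h2 := he (z i₀) u
    rw [hz] at h2
    rw [abs_le] at *
    constructor <;> linarith
  have hpos : 0 < 1 - (β - η) := by linarith
  have hD' : D ≤ e / (1 - (β - η)) := by
    rw [le_div_iff₀ hpos]
    linarith
  -- With `α = β - η`, passing from `v` to `w` and back costs `d + e + (1 + α) * D`. Inserting `D ≤
  -- e / (1 - α)` gives `d + 2 * e / (1 - α)`.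
  have h1 := (abs_le.1 (he x (f (idx x)))).1
  have h2 := (abs_le.1 (hq (idx x) (f (idx x)))).1
  have h3 := hf (idx x)
  have h4 := (abs_le.1 (hi₀ (idx x))).2
  have h5 := (abs_le.1 (hd x)).2
  have hle : η ≤ β := by
    have := hmin (idx x, f (idx x)) Set.univ
    simp only [Measure.smul_apply, measure_univ, smul_eq_mul, mul_one] at this
    exact (ENNReal.ofReal_le_ofReal_iff hβ).1 this
  have h6 : 2 * e / (1 - (β - η)) = 2 * (e / (1 - (β - η))) := by ring
  have h7 : e = (1 - (β - η)) * (e / (1 - (β - η))) := (mul_div_cancel₀ _ hpos.ne').symm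
  have h8 := mul_le_mul_of_nonneg_left hD' (by linarith : 0 ≤ 1 + (β - η))
  linarith

end Comparison

/-! ### One-step comparison of the learned and the original model -/

section Learned

variable {X U : Type*} [MetricSpace X] [SecondCountableTopology X] [MeasurableSpace X]
  [BorelSpace X] [MetricSpace U] [MeasurableSpace U] [BorelSpace U] [Fintype U] [Nonempty U]
  {c : X → U → ℝ} {T : Kernel (X × U) X} [IsMarkovKernel T] {K : ℝ} {Lc LT : ℝ≥0}
  {M : ℕ} (B : BinPartition X M) (π : Measure X) [IsProbabilityMeasure π] {N₀ : ℕ} [NeZero N₀]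

lemma integral_estKernel (ys : Fin N₀ → Fin M → U → X) (i : Fin M) (u : U) (h : Fin M → ℝ) :
    ∫ j, h j ∂(B.estKernel ys (i, u)) = (1 / (N₀ : ℝ)) * ∑ k, h (B.index (ys k i u)) := by
  have hk : B.estKernel ys (i, u) =
      ∑ j, ENNReal.ofReal (B.estTransition ys i u j) • Measure.dirac j := rfl
  rw [hk, integral_finsetSum_measure fun j _ =>
    (Integrable.of_finite (μ := Measure.dirac j)).smul_measure ENNReal.ofReal_ne_top]
  simp only [integral_smul_measure, integral_dirac, smul_eq_mul,
    ENNReal.toReal_ofReal (B.estTransition_nonneg ys i u _)]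
  simp only [BinPartition.estTransition, mul_assoc, ← Finset.mul_sum, Finset.sum_mul]
  rw [Finset.sum_comm]
  congr 1
  refine Finset.sum_congr rfl fun k _ => ?_
  classical
  simp [Set.indicator_apply, ← B.index_eq_iff]

/-- The deviation of the empirical state-action values from their mean, for the value
function `v`. -/
def empiricalDeviation (β : ℝ) (c : X → U → ℝ) (T : Kernel (X × U) X) (v : X → ℝ)
    (xs ys : Fin N₀ → Fin M → U → X) (i : Fin M) (u : U) : ℝ :=
  (1 / (N₀ : ℝ)) * ∑ k, (c (xs k i u) u + β * v (ys k i u)) -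
    ∫ x, (c x u + β * ∫ y, v y ∂(T (x, u))) ∂(ProbabilityTheory.cond π (B.bin i))

lemma abs_mean_le_of_forall_abs_le {a : Fin N₀ → ℝ} {b : ℝ} (h : ∀ k, |a k| ≤ b) :
    |(1 / (N₀ : ℝ)) * ∑ k, a k| ≤ b := by
  have hN : 0 < (N₀ : ℝ) := Nat.cast_pos.2 (Nat.pos_of_ne_zero (NeZero.ne N₀))
  rw [abs_mul, abs_of_nonneg (by positivity), one_div, inv_mul_le_iff₀ hN]
  refine (Finset.abs_sum_le_sum_abs _ _).trans ((Finset.sum_le_sum fun k _ => h k).trans ?_)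
  simp

lemma cost_measurable (h : IsWassersteinRegular c T K Lc LT) :
    Measurable fun p : X × U => c p.1 p.2 :=
  h.cost_continuous.measurable

/-- The state-action value is `L`-Lipschitz in the state, hence varies by at most `L * δ` within a
bin, whatever the distribution used to average over the bin. -/
lemma abs_mean_sub_le (h : IsWassersteinRegular c T K Lc LT)
    {v : X → ℝ} (hv : Measurable v) {D : ℝ} (hD : ∀ x, |v x| ≤ D) {L δ : ℝ} (hL : 0 ≤ L)
    (hvL : ∀ x y, |v x - v y| ≤ L * dist x y) {β : ℝ} (hβ : 0 ≤ β) (hLL : Lc + β * LT * L ≤ L)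
    {i : Fin M} (hπ : 0 < π (B.bin i))
    (hδ : ∀ x y, B.index x = B.index y → dist x y ≤ δ) {x : X} (hx : x ∈ B.bin i) (u : U) :
    |∫ y, (c y u + β * ∫ z, v z ∂(T (y, u))) ∂(ProbabilityTheory.cond π (B.bin i)) -
      (c x u + β * ∫ z, v z ∂(T (x, u)))| ≤ L * δ := by
  have : IsProbabilityMeasure (ProbabilityTheory.cond π (B.bin i)) :=
    cond_isProbabilityMeasure hπ.ne'
  set q : X → ℝ := fun y => c y u + β * ∫ z, v z ∂(T (y, u)) with hq
  have hqm : Measurable q :=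
    ((cost_measurable h).comp (by fun_prop : Measurable fun y : X => (y, u))).add
      (((measurable_integral_kernel T hv).comp
        (by fun_prop : Measurable fun y : X => (y, u))).const_mul β)
  have hqb (y) : |q y| ≤ K + β * D := by
    refine (abs_add_le _ _).trans (add_le_add ?_ ?_)
    · rw [abs_of_nonneg (h.cost_nonneg y u)]
      exact h.cost_le y u
    · rw [abs_mul, abs_of_nonneg hβ]
      exact mul_le_mul_of_nonneg_left (abs_integral_le_of_abs_le hD) hβ
  have h1 : ∫ y, q y ∂(ProbabilityTheory.cond π (B.bin i)) - q x =
      ∫ y, (q y - q x) ∂(ProbabilityTheory.cond π (B.bin i)) := by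
    rw [integral_sub (integrable_of_abs_le hqm hqb) (integrable_const _)]
    simp
  rw [h1]
  have h2 := norm_integral_le_of_norm_le_const (μ := ProbabilityTheory.cond π (B.bin i))
    (f := fun y => q y - q x) (C := L * δ) (by
      filter_upwards [ae_cond_mem (B.measurableSet_bin i)] with y hy
      refine (h.abs_mul_integral_sub_le hv hD hL hvL hβ y x u).trans ?_
      refine (mul_le_mul_of_nonneg_right hLL dist_nonneg).trans
        (mul_le_mul_of_nonneg_left (hδ y x ?_) hL)
      rw [(B.index_eq_iff y i).2 hy, (B.index_eq_iff x i).2 hx])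
  simpa using h2

variable {B π}

/-- The state-action values of the learned and of the original model are close, up to the
quantization error and the statistical error. -/
lemma abs_qValue_learned_sub_le (h : IsWassersteinRegular c T K Lc LT)
    {ρ : Measure X} [IsProbabilityMeasure ρ] (hπ : ∀ i, 0 < π (B.bin i))
    {v : X → ℝ} (hv : Measurable v) {D : ℝ} (hD : ∀ x, |v x| ≤ D) {L δ : ℝ} (hL : 0 ≤ L)
    (hvL : ∀ x y, |v x - v y| ≤ L * dist x y) {β η : ℝ} (hβ : 0 ≤ β) (hβ1 : β ≤ 1) (hη : 0 ≤ η)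
    (hη1 : η ≤ 1) (hLL : Lc + β * LT * L ≤ L)
    (hδ : ∀ x y, B.index x = B.index y → dist x y ≤ δ)
    {z : Fin M → X} (hz : ∀ i, B.index (z i) = i)
    (xs ys : Fin N₀ → Fin M → U → X) {E : ℝ}
    (hE : ∀ i u, |empiricalDeviation B π β c T v xs ys i u| ≤ E) (x : X) (u : U) :
    |qValue β η (BinPartition.estCost c xs) (B.estKernel ys) (ρ.map B.index)
      (fun i => v (z i)) (B.index x) u - qValue β η c T ρ v x u| ≤ 3 * (L * δ) + E := by
  have hvz (y : X) : |v (z (B.index y)) - v y| ≤ L * δ :=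
    (hvL _ _).trans (mul_le_mul_of_nonneg_left (hδ _ _ (hz _)) hL)
  have hLδ : 0 ≤ L * δ := (abs_nonneg _).trans (hvz x)
  set i := B.index x with hi
  -- Besides the statistical error `E` there are three quantization errors of size `L * δ`:
  -- averaging over the bin instead of evaluating at `x` (`h2`), and replacing `v` by its value at
  -- representatives in the sample mean (`h3`) and in the `ρ`-integral (`h4`).
  have h1 := hE i u
  have h2 := abs_mean_sub_le B π h hv hD hL hvL hβ hLL (hπ i) hδ (B.mem_bin_index x) u
  have h3 : |(1 / (N₀ : ℝ)) * ∑ k, β * (v (z (B.index (ys k i u))) - v (ys k i u))| ≤ L * δ := by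
    refine abs_mean_le_of_forall_abs_le fun k => ?_
    rw [abs_mul, abs_of_nonneg hβ]
    exact (mul_le_of_le_one_left (abs_nonneg _) hβ1).trans (hvz _)
  have hvzm : Measurable fun y => v (z (B.index y)) :=
    (Measurable.of_discrete (f := fun i => v (z i))).comp B.measurable_index
  have h4 : |η * ∫ y, (v (z (B.index y)) - v y) ∂ρ| ≤ L * δ := by
    rw [abs_mul, abs_of_nonneg hη]
    exact (mul_le_of_le_one_left (abs_nonneg _) hη1).trans (abs_integral_le_of_abs_le hvz)
  rw [integral_sub (integrable_of_abs_le hvzm fun y => hD _) (integrable_of_abs_le hv hD)] at h4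
  have h5 : ∫ j, v (z j) ∂(ρ.map B.index) = ∫ y, v (z (B.index y)) ∂ρ :=
    integral_map B.measurable_index.aemeasurable Measurable.of_discrete.aestronglyMeasurable
  unfold qValue
  rw [integral_estKernel, h5, BinPartition.estCost]
  unfold empiricalDeviation at h1
  simp only [← Finset.mul_sum, Finset.sum_sub_distrib, Finset.sum_add_distrib, mul_add,
    mul_sub] at h1 h3 h4
  rw [abs_le] at *
  constructor <;> linarith

/-- A policy that is greedy for the value function of the learned model is nearly greedy for the
value function of the original model. -/
theorem qValue_extend_sub_le (h : IsWassersteinRegular c T K Lc LT)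
    {ρ : Measure X} [IsProbabilityMeasure ρ] (hπ : ∀ i, 0 < π (B.bin i))
    {β η : ℝ} (hβ : 0 ≤ β) (hβ1 : β ≤ 1) (hη : 0 ≤ η)
    (hη1 : η ≤ 1) (hβη : β - η < 1) {v : X → ℝ} (hv : Measurable v) {D : ℝ} (hD : ∀ x, |v x| ≤ D)
    {L δ : ℝ} (hL : 0 ≤ L) (hvL : ∀ x y, |v x - v y| ≤ L * dist x y) (hLL : Lc + β * LT * L ≤ L)
    (hvfix : ∀ x, v x = Finset.univ.inf' Finset.univ_nonempty (qValue β η c T ρ v x))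
    (hδ : ∀ x y, B.index x = B.index y → dist x y ≤ δ)
    (xs ys : Fin N₀ → Fin M → U → X) {E : ℝ}
    (hE : ∀ i u, |empiricalDeviation B π β c T v xs ys i u| ≤ E)
    (hmin : ∀ p, ENNReal.ofReal η • ρ.map B.index ≤ ENNReal.ofReal β • B.estKernel ys p)
    {w : Fin M → ℝ} (hw : ∀ i, w i = Finset.univ.inf' Finset.univ_nonempty
      (qValue β η (BinPartition.estCost c xs) (B.estKernel ys) (ρ.map B.index) w i))
    {f : Fin M → U} (hf : ∀ i, qValue β η (BinPartition.estCost c xs) (B.estKernel ys)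
      (ρ.map B.index) w i (f i) ≤ w i) (x : X) :
    qValue β η c T ρ v x (B.extend f x) - v x ≤
      L * δ + 2 * (3 * (L * δ) + E) / (1 - (β - η)) := by
  have : IsProbabilityMeasure (ρ.map B.index) :=
    Measure.isProbabilityMeasure_map B.measurable_index.aemeasurable
  -- Bins of positive mass are nonempty, which provides the representatives `z`.
  have hne (i : Fin M) : ∃ y, B.index y = i := by
    obtain ⟨y, hy⟩ := nonempty_of_measure_ne_zero (hπ i).ne'
    exact ⟨y, (B.index_eq_iff y i).2 hy⟩
  choose z hz using hne
  exact qValue_sub_le_of_greedy hβ hη hβη hmin hvfix hw B.index z hz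
    (abs_qValue_learned_sub_le h hπ hv hD hL hvL hβ hβ1 hη hη1 hLL hδ hz xs ys hE)
    (fun y => (hvL _ _).trans (mul_le_mul_of_nonneg_left (hδ _ _ (hz _)) hL)) hf x

end Learned

/-! ### Maximal and Chernoff inequalities -/

section Concentration

variable {Ω : Type*} [MeasurableSpace Ω] {P : Measure Ω} [IsProbabilityMeasure P]

/-- The expected maximum of finitely many sub-Gaussian variables, through an integrable majorant. -/
lemma exists_integrable_forall_abs_le {ι : Type*} [Fintype ι] (hι : 2 ≤ Fintype.card ι)
    {N : ℕ} (hN : N ≠ 0) {b : ℝ} {σ : ι → ℝ≥0} (hσ : ∀ i, (σ i : ℝ) ≤ b ^ 2 / N)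
    {Z : ι → Ω → ℝ} (hZ : ∀ i, HasSubgaussianMGF (Z i) (σ i) P) :
    ∃ G : Ω → ℝ, Integrable G P ∧ (∀ i ω, |Z i ω| ≤ G ω) ∧
      ∫ ω, G ω ∂P ≤ (4 + b ^ 2 / 2) * √(Real.log (Fintype.card ι) / N) := by
  set m : ℝ := (Fintype.card ι : ℝ) with hm
  have hm2 : (2 : ℝ) ≤ m := by
    rw [hm]
    exact_mod_cast hι
  have hN0 : (0 : ℝ) < N := Nat.cast_pos.2 (Nat.pos_of_ne_zero hN)
  have hlog2 : Real.log 2 ≤ Real.log m := Real.log_le_log two_pos hm2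
  have hl := Real.log_two_gt_d9
  set l := Real.log m with hl_def
  have hl0 : 0 < l := by linarith
  -- The exponent `s` balances `l / s` against `s * b ^ 2 / N`. The level `a` is chosen so that `exp
  -- (-(s * a))` times the bound `2 * m * exp (b ^ 2 * l / 2)` on the expected sum of exponentials
  -- equals 1.
  set s := √(N * l) with hs
  have hs0 : 0 < s := Real.sqrt_pos.2 (by positivity)
  have hs2 : s ^ 2 = N * l := Real.sq_sqrt (by positivity)
  set a := (Real.log (2 * m) + b ^ 2 * l / 2) / s with ha
  set A := 1 / s * Real.exp (-(s * a)) with hA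
  have hA0 : 0 ≤ A := by positivity
  have hint (i : ι) (r : ℝ) : Integrable (fun ω => Real.exp (r * Z i ω)) P :=
    (hZ i).integrable_exp_mul r
  have hint2 (i : ι) : Integrable (fun ω => Real.exp (s * Z i ω) + Real.exp (-s * Z i ω)) P :=
    (hint i s).add (hint i (-s))
  -- From `1 + t ≤ exp t` with `t = s * (y - a)`. Summing the exponentials then majorizes all `|Z
  -- i|` at once, without independence across `i`.
  have hpt (y : ℝ) : y ≤ a + A * Real.exp (s * y) := by
    have h1 := Real.add_one_le_exp (s * (y - a))
    have h2 : A * Real.exp (s * y) = 1 / s * Real.exp (s * (y - a)) := by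
      rw [hA, mul_assoc, ← Real.exp_add]
      congr 2
      ring
    have h3 : 1 / s * (s * (y - a)) ≤ 1 / s * Real.exp (s * (y - a)) :=
      mul_le_mul_of_nonneg_left (by linarith) (by positivity)
    rw [← mul_assoc, one_div_mul_cancel hs0.ne', one_mul] at h3
    rw [h2]
    linarith
  have hexp (i : ι) (r : ℝ) (hr : r ^ 2 = s ^ 2) :
      ∫ ω, Real.exp (r * Z i ω) ∂P ≤ Real.exp (b ^ 2 * l / 2) := by
    refine ((hZ i).mgf_le r).trans (Real.exp_le_exp.2 ?_)
    rw [hr, hs2]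
    have h1 := mul_le_mul_of_nonneg_right (hσ i) (by positivity : 0 ≤ N * l)
    have h2 : b ^ 2 / N * (N * l) = b ^ 2 * l := by field_simp
    linarith
  refine ⟨fun ω => a + A * ∑ i, (Real.exp (s * Z i ω) + Real.exp (-s * Z i ω)), ?_, ?_, ?_⟩
  · exact (integrable_const a).add ((integrable_finsetSum _ fun i _ =>
      hint2 i).const_mul A)
  · intro i ω
    have h1 : Real.exp (s * |Z i ω|) ≤ Real.exp (s * Z i ω) + Real.exp (-s * Z i ω) := by
      have p1 := Real.exp_pos (s * Z i ω)
      have p2 := Real.exp_pos (-s * Z i ω)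
      rcases abs_cases (Z i ω) with ⟨h, -⟩ | ⟨h, -⟩
      · rw [h]
        linarith
      · rw [h, mul_neg, ← neg_mul]
        linarith
    have h2 := Finset.single_le_sum
      (f := fun i => Real.exp (s * Z i ω) + Real.exp (-s * Z i ω))
      (fun i _ => by positivity) (Finset.mem_univ i)
    exact (hpt _).trans (add_le_add_right (mul_le_mul_of_nonneg_left (h1.trans h2) hA0) a)
  · have h0 : ∫ ω, (a + A * ∑ i, (Real.exp (s * Z i ω) + Real.exp (-s * Z i ω))) ∂P =
        a + A * ∑ i, ∫ ω, (Real.exp (s * Z i ω) + Real.exp (-s * Z i ω)) ∂P := by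
      rw [integral_add (integrable_const a) ((integrable_finsetSum _ fun i _ =>
        hint2 i).const_mul A), integral_const_mul,
        integral_finsetSum _ fun i _ => hint2 i]
      simp
    rw [h0]
    have h1 : ∑ i, ∫ ω, (Real.exp (s * Z i ω) + Real.exp (-s * Z i ω)) ∂P ≤
        2 * m * Real.exp (b ^ 2 * l / 2) := by
      calc _ ≤ ∑ i : ι, 2 * Real.exp (b ^ 2 * l / 2) := by
            refine Finset.sum_le_sum fun i _ => ?_
            rw [integral_add (hint i s) (hint i (-s)), two_mul]
            exact add_le_add (hexp i s rfl) (hexp i (-s) (neg_sq s))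
        _ = _ := by
            rw [Finset.sum_const, nsmul_eq_mul, Finset.card_univ, ← hm]
            ring
    have h2 : A * (2 * m * Real.exp (b ^ 2 * l / 2)) = 1 / s := by
      have h3 : s * a = Real.log (2 * m) + b ^ 2 * l / 2 := by
        rw [ha]
        field_simp
      rw [hA, h3, neg_add, Real.exp_add, Real.exp_neg, Real.exp_log (by positivity), Real.exp_neg]
      field_simp
    have h4 := mul_le_mul_of_nonneg_left h1 hA0
    have h5 : √(l / N) = l / s := by
      rw [eq_div_iff hs0.ne', hs, ← Real.sqrt_mul (by positivity)]
      have : l / N * (N * l) = l * l := by field_simp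
      rw [this, Real.sqrt_mul_self hl0.le]
    -- Here `m ≥ 2` matters: `l ≥ log 2` absorbs both `log 2` and the constant 1 into multiples of
    -- `l`.
    have h6 : Real.log (2 * m) ≤ 2 * l := by
      rw [Real.log_mul two_ne_zero (by positivity)]
      linarith
    calc _ ≤ a + 1 / s := by linarith
      _ = (Real.log (2 * m) + b ^ 2 * l / 2 + 1) / s := by rw [ha]; ring
      _ ≤ ((4 + b ^ 2 / 2) * l) / s := by
          refine div_le_div_of_nonneg_right ?_ hs0.le
          linarith
      _ = _ := by rw [h5]; ring

/-- A lower Chernoff bound for the empirical frequency of independent events of the same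
probability. -/
lemma measureReal_mean_lt_half_le {N : ℕ} [NeZero N] {Y : Fin N → Ω → ℝ}
    (hind : iIndepFun Y P) (hm : ∀ k, AEMeasurable (Y k) P) (h01 : ∀ k ω, Y k ω = 0 ∨ Y k ω = 1)
    {p : ℝ} (hp : 0 ≤ p) (hmean : ∀ k, ∫ ω, Y k ω ∂P = p) :
    P.real {ω | (1 / (N : ℝ)) * ∑ k, Y k ω < p / 2} ≤ Real.exp (-(p * N / 8)) := by
  have hN0 : (0 : ℝ) < N := Nat.cast_pos.2 (Nat.pos_of_ne_zero (NeZero.ne N))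
  have hi (k) : Integrable (Y k) P := by
    refine Integrable.of_bound (hm k).aestronglyMeasurable 1 (ae_of_all _ fun ω => ?_)
    rcases h01 k ω with h | h <;> simp [h]
  -- On `{0, 1}` the exponential is affine, and `1 - exp (-1) ≥ 5 / 8`. The Chernoff exponent at
  -- parameter `-1` is then `1 / 2 - 5 / 8 = -1 / 8`.
  have hmgf (k) : mgf (Y k) P (-1) ≤ Real.exp (-(p * (5 / 8))) := by
    have h1 (ω) : Real.exp (-1 * Y k ω) = 1 - (1 - Real.exp (-1)) * Y k ω := by
      rcases h01 k ω with h | h <;> simp [h]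
    unfold mgf
    simp_rw [h1]
    rw [integral_sub (integrable_const _) ((hi k).const_mul _), integral_const_mul, hmean]
    simp only [integral_const, probReal_univ, smul_eq_mul, one_mul]
    have h2 : Real.exp (-1) ≤ 3 / 8 := by
      have := Real.exp_neg_one_lt_d9
      linarith
    have h3 := Real.add_one_le_exp (-(p * (5 / 8)))
    nlinarith
  have hsum : Integrable (fun ω => Real.exp (-1 * (∑ k, Y k) ω)) P := by
    refine Integrable.of_bound (C := 1) ?_ (ae_of_all _ fun ω => ?_)
    · have : AEMeasurable (∑ k, Y k) P := Finset.aemeasurable_sum _ fun k _ => hm k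
      exact (Real.measurable_exp.comp_aemeasurable (this.const_mul _)).aestronglyMeasurable
    · rw [Real.norm_eq_abs, Real.abs_exp, Finset.sum_apply, Real.exp_le_one_iff]
      have : 0 ≤ ∑ k, Y k ω := Finset.sum_nonneg fun k _ => by
        rcases h01 k ω with h | h <;> simp [h]
      linarith
  calc P.real {ω | (1 / (N : ℝ)) * ∑ k, Y k ω < p / 2}
      ≤ P.real {ω | (∑ k, Y k) ω ≤ p * N / 2} := by
        refine measureReal_mono fun ω hω => ?_
        simp only [Set.mem_ofPred_eq, one_div, inv_mul_lt_iff₀ hN0] at hω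
        simp only [Set.mem_ofPred_eq, Finset.sum_apply]
        linarith
    _ ≤ Real.exp (- (-1) * (p * N / 2)) * mgf (∑ k, Y k) P (-1) :=
        measure_le_le_exp_mul_mgf _ (by norm_num) hsum
    _ ≤ Real.exp (- (-1) * (p * N / 2)) * Real.exp (-(p * (5 / 8))) ^ N := by
        refine mul_le_mul_of_nonneg_left ?_ (Real.exp_nonneg _)
        rw [hind.mgf_sum₀ hm]
        refine (Finset.prod_le_prod (fun k _ => mgf_nonneg) fun k _ => hmgf k).trans ?_
        simp
    _ = Real.exp (-(p * N / 8)) := by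
        rw [← Real.exp_nat_mul, ← Real.exp_add]
        congr 1
        ring

end Concentration

/-! ### Concentration of the sampled costs and transitions -/

section Sample

variable {X U : Type*} [MeasurableSpace X] [MeasurableSpace U]
  {c : X → U → ℝ} {T : Kernel (X × U) X} [IsMarkovKernel T]
  {M : ℕ} {B : BinPartition X M} {π : Measure X} [IsProbabilityMeasure π] {N₀ : ℕ} [NeZero N₀]
  {Ω : Type*} [MeasurableSpace Ω] {P : Measure Ω} [IsProbabilityMeasure P]
  {xs ys : Ω → Fin N₀ → Fin M → U → X}

lemma IsTransitionSample.integral_eq (hs : IsTransitionSample P B π T xs ys)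
    (hπ : ∀ i, 0 < π (B.bin i)) (k : Fin N₀) (i : Fin M) (u : U) {φ : X × X → ℝ}
    (hφ : Measurable φ) {b : ℝ} (hb : ∀ p, |φ p| ≤ b) :
    ∫ ω, φ (xs ω k i u, ys ω k i u) ∂P =
      ∫ x, ∫ y, φ (x, y) ∂(T (x, u)) ∂(ProbabilityTheory.cond π (B.bin i)) := by
  have : IsProbabilityMeasure (ProbabilityTheory.cond π (B.bin i)) :=
    cond_isProbabilityMeasure (hπ i).ne'
  have h := (hs.hasLaw k i u).integral_comp (f := φ) hφ.aestronglyMeasurable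
  rw [Measure.integral_compProd (integrable_of_abs_le hφ hb)] at h
  exact h

/-- Hoeffding's lemma: each summand lies in an interval of length `2 * (K + D)`, so has variance
proxy `(K + D) ^ 2`; averaging `N₀` independent copies divides it by `N₀`. It matters that `v` does
not depend on the sample. -/
lemma IsTransitionSample.hasSubgaussianMGF (hs : IsTransitionSample P B π T xs ys)
    (hπ : ∀ i, 0 < π (B.bin i)) (hc : Measurable (fun p : X × U => c p.1 p.2)) {K : ℝ}
    (hK : ∀ x u, |c x u| ≤ K) {v : X → ℝ} (hv : Measurable v) {D : ℝ} (hD : ∀ x, |v x| ≤ D)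
    {β : ℝ} (hβ : 0 ≤ β) (hβ1 : β ≤ 1) (i : Fin M) (u : U) :
    ∃ σ : ℝ≥0, (σ : ℝ) ≤ (K + D) ^ 2 / N₀ ∧
      HasSubgaussianMGF (fun ω => empiricalDeviation B π β c T v (xs ω) (ys ω) i u) σ P := by
  have hN0 : (0 : ℝ) < N₀ := Nat.cast_pos.2 (Nat.pos_of_ne_zero (NeZero.ne N₀))
  set φ : X × X → ℝ := fun p => c p.1 u + β * v p.2 with hφ_def
  have hφ : Measurable φ :=
    (hc.comp (by fun_prop : Measurable fun p : X × X => (p.1, u))).add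
      ((hv.comp measurable_snd).const_mul β)
  have hb (p) : |φ p| ≤ K + D := by
    refine (abs_add_le _ _).trans (add_le_add (hK _ _) ?_)
    rw [abs_mul, abs_of_nonneg hβ]
    exact (mul_le_of_le_one_left (abs_nonneg _) hβ1).trans (hD _)
  have hmean (k : Fin N₀) : ∫ ω, φ (xs ω k i u, ys ω k i u) ∂P =
      ∫ x, (c x u + β * ∫ y, v y ∂(T (x, u))) ∂(ProbabilityTheory.cond π (B.bin i)) := by
    rw [hs.integral_eq hπ k i u hφ hb]
    refine integral_congr_ae (ae_of_all _ fun x => ?_)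
    simp only [hφ_def]
    rw [integral_add (integrable_const _) ((integrable_of_abs_le hv hD).const_mul β),
      integral_const_mul]
    simp
  have hsub (k : Fin N₀) := hasSubgaussianMGF_of_mem_Icc (μ := P)
    (X := fun ω => φ (xs ω k i u, ys ω k i u)) (a := -(K + D)) (b := K + D)
    (hφ.comp_aemeasurable (hs.hasLaw k i u).aemeasurable)
    (ae_of_all _ fun ω => abs_le.1 (hb _))
  have hind : iIndepFun (fun k ω => φ (xs ω k i u, ys ω k i u) -
      ∫ ω', φ (xs ω' k i u, ys ω' k i u) ∂P) P :=
    (hs.indep i u).comp (fun k p => φ p - ∫ ω', φ (xs ω' k i u, ys ω' k i u) ∂P)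
      fun k => hφ.sub_const _
  have hsum := (HasSubgaussianMGF.sum_of_iIndepFun hind (s := Finset.univ)
    fun k _ => hsub k).const_mul (1 / (N₀ : ℝ))
  refine ⟨_, ?_, hsum.congr (ae_of_all _ fun ω => ?_)⟩
  · change (1 / (N₀ : ℝ)) ^ 2 *
      ((∑ _k : Fin N₀, (‖K + D - -(K + D)‖₊ / 2) ^ 2 : ℝ≥0) : ℝ) ≤ _
    have hKD : ‖K + D - -(K + D)‖ / 2 = |K + D| := by
      rw [Real.norm_eq_abs, sub_neg_eq_add, ← two_mul, abs_mul, abs_two,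
        mul_div_cancel_left₀ _ (two_ne_zero' ℝ)]
    rw [NNReal.coe_sum]
    push_cast
    rw [hKD, sq_abs, Finset.sum_const, Finset.card_univ, Fintype.card_fin, nsmul_eq_mul]
    refine le_of_eq ?_
    field_simp
  · simp only [Finset.sum_sub_distrib, mul_sub, hmean, empiricalDeviation]
    simp only [Finset.sum_const, Finset.card_univ, Fintype.card_fin, nsmul_eq_mul, hφ_def]
    field_simp

lemma IsTransitionSample.measureReal_estTransition_lt_le (hs : IsTransitionSample P B π T xs ys)
    (hπ : ∀ i, 0 < π (B.bin i)) (i j : Fin M) (u : U) :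
    P.real {ω | B.estTransition (ys ω) i u j < B.quantizedTransition π T i u j / 2} ≤
      Real.exp (-(B.quantizedTransition π T i u j * N₀ / 8)) := by
  have hg : Measurable ((B.bin j).indicator (fun _ => (1 : ℝ))) :=
    measurable_const.indicator (B.measurableSet_bin j)
  have h01 (x : X) : (B.bin j).indicator (fun _ => (1 : ℝ)) x = 0 ∨
      (B.bin j).indicator (fun _ => (1 : ℝ)) x = 1 := by
    by_cases h : x ∈ B.bin j <;> simp [h]
  refine measureReal_mean_lt_half_le
    (Y := fun k ω => (B.bin j).indicator (fun _ => (1 : ℝ)) (ys ω k i u))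
    ((hs.indep i u).comp (fun _ p => (B.bin j).indicator (fun _ => (1 : ℝ)) p.2)
      fun _ => hg.comp measurable_snd)
    (fun k => (hg.comp measurable_snd).comp_aemeasurable (hs.hasLaw k i u).aemeasurable)
    (fun k ω => h01 _) ?_ fun k => ?_
  · exact div_nonneg (integral_nonneg fun _ => measureReal_nonneg) measureReal_nonneg
  · rw [hs.integral_eq hπ k i u
      (φ := fun p => (B.bin j).indicator (fun _ => (1 : ℝ)) p.2) (hg.comp measurable_snd) (b := 1)
      fun p => by rcases h01 p.2 with h | h <;> simp [h]]
    have h1 (x : X) : ∫ y, (B.bin j).indicator (fun _ => (1 : ℝ)) y ∂(T (x, u)) =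
        (T (x, u)).real (B.bin j) := integral_indicator_one (B.measurableSet_bin j)
    simp_rw [h1]
    rw [ProbabilityTheory.cond, integral_smul_measure, BinPartition.quantizedTransition,
      ENNReal.toReal_inv, smul_eq_mul, div_eq_inv_mul]
    rfl

end Sample

/-! ### Fixed points as solutions of the optimality equations -/

section FixedPointGap

variable {S U : Type*} [MeasurableSpace S] [MeasurableSpace U] [Fintype U] [Nonempty U]
  {β η : ℝ} {c : S → U → ℝ} {T : Kernel (S × U) S} {ρ : Measure S} {v : S → ℝ}

lemma bellmanGap_nonneg_of_fixedPoint
    (hv : ∀ x, v x = Finset.univ.inf' Finset.univ_nonempty (qValue β η c T ρ v x)) (p : S × U) :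
    0 ≤ bellmanGap β c T v (η * ∫ y, v y ∂ρ) p := by
  have h := bellmanGap_eq_qValue_sub β η c T ρ v p.1 p.2
  rw [Prod.mk.eta] at h
  rw [h, sub_nonneg, hv p.1]
  exact Finset.inf'_le _ (Finset.mem_univ p.2)

lemma exists_qValue_eq_of_fixedPoint
    (hv : ∀ x, v x = Finset.univ.inf' Finset.univ_nonempty (qValue β η c T ρ v x)) (x : S) :
    ∃ u, qValue β η c T ρ v x u = v x := by
  obtain ⟨u, -, hu⟩ := Finset.univ.exists_mem_eq_inf' Finset.univ_nonempty (qValue β η c T ρ v x)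
  exact ⟨u, by rw [hv x, hu]⟩

lemma exists_bellmanGap_nonpos_of_fixedPoint
    (hv : ∀ x, v x = Finset.univ.inf' Finset.univ_nonempty (qValue β η c T ρ v x)) (x : S) :
    ∃ u, bellmanGap β c T v (η * ∫ y, v y ∂ρ) (x, u) ≤ 0 := by
  obtain ⟨u, hu⟩ := exists_qValue_eq_of_fixedPoint hv x
  exact ⟨u, by rw [bellmanGap_eq_qValue_sub, hu, sub_self]⟩

end FixedPointGap

/-! ### Optimal policies of the learned model are greedy -/

section FiniteModel

variable {X U : Type*} [MetricSpace X] [SecondCountableTopology X] [MeasurableSpace X]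
  [BorelSpace X] [MetricSpace U] [MeasurableSpace U] [BorelSpace U] [Fintype U] [Nonempty U]
  {c : X → U → ℝ} {T : Kernel (X × U) X} [IsMarkovKernel T] {K : ℝ} {Lc LT : ℝ≥0}
  {M : ℕ} {B : BinPartition X M} {π : Measure X} [IsProbabilityMeasure π] {N₀ : ℕ} [NeZero N₀]

lemma abs_estCost_le (hK : ∀ x u, |c x u| ≤ K) (xs : Fin N₀ → Fin M → U → X) (i : Fin M)
    (u : U) : |BinPartition.estCost c xs i u| ≤ K :=
  abs_mean_le_of_forall_abs_le fun _ => hK _ _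

/-- The labels are discrete, so continuity is automatic and the whole space serves as the invariant
set. -/
lemma exists_learned_fixedPoint (hK : ∀ x u, |c x u| ≤ K) (xs ys : Fin N₀ → Fin M → U → X)
    {ρ : Measure X} [IsProbabilityMeasure ρ] {β η : ℝ} (hβ : 0 ≤ β) (hη : 0 ≤ η)
    (hβη : β - η < 1)
    (hmin : ∀ p, ENNReal.ofReal η • ρ.map B.index ≤ ENNReal.ofReal β • B.estKernel ys p) :
    ∃ w : Fin M → ℝ, (∀ i, w i = Finset.univ.inf' Finset.univ_nonempty
      (qValue β η (BinPartition.estCost c xs) (B.estKernel ys) (ρ.map B.index) w i)) ∧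
      ∀ i, |w i| ≤ K / (1 - (β - η)) := by
  have : IsProbabilityMeasure (ρ.map B.index) :=
    Measure.isProbabilityMeasure_map B.measurable_index.aemeasurable
  obtain ⟨w, -, hw, hwb⟩ := exists_bellman_fixedPoint hβ hη hβη hmin
    (abs_estCost_le hK xs) (fun _ => continuous_of_discreteTopology)
    (fun _ _ => continuous_of_discreteTopology) Set.univ isClosed_univ (Set.mem_univ _)
    (fun _ _ _ _ => Set.mem_univ _)
  exact ⟨w, hw, hwb⟩

/-- An optimal policy of the learned discounted model is greedy for its value function. -/
lemma IsDiscountedOptimal.greedy (hK : ∀ x u, |c x u| ≤ K) {xs ys : Fin N₀ → Fin M → U → X}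
    {ρ : Measure X} {β : ℝ} (hβ : 0 ≤ β) (hβ1 : β < 1)
    {w : Fin M → ℝ} (hw : ∀ i, w i = Finset.univ.inf' Finset.univ_nonempty
      (qValue β 0 (BinPartition.estCost c xs) (B.estKernel ys) (ρ.map B.index) w i))
    {D : ℝ} (hD : ∀ i, |w i| ≤ D) {f : Fin M → U}
    (hf : IsDiscountedOptimal β (BinPartition.estCost c xs) (B.estKernel ys) f) (i : Fin M) :
    qValue β 0 (BinPartition.estCost c xs) (B.estKernel ys) (ρ.map B.index) w i (f i) ≤ w i := by
  obtain ⟨hfm, hf⟩ := hf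
  have h1 := bellmanGap_nonneg_of_fixedPoint hw
  have h2 := exists_bellmanGap_nonpos_of_fixedPoint hw
  rw [zero_mul] at h1
  simp only [zero_mul] at h2
  have h3 := optDiscountedCost_eq .of_discrete (abs_estCost_le hK xs) (B.estKernel ys) i
    .of_discrete hD hβ hβ1 h1 h2
  have h4 := bellmanGap_stationary_le .of_discrete (abs_estCost_le hK xs) (B.estKernel ys) i
    .of_discrete hD hβ hβ1 h1 f hfm
  rw [hf i, h3, bellmanGap_zero_eq_qValue_sub _ _ _ (ρ.map B.index)] at h4
  linarith

/-- If the learned model is minorized, then an optimal policy for the average cost is greedy for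
a fixed point of its (contractive) Bellman operator. -/
lemma IsAverageOptimal.exists_greedy (hK : ∀ x u, |c x u| ≤ K)
    {xs ys : Fin N₀ → Fin M → U → X} {ρ : Measure X} [IsProbabilityMeasure ρ] {η : ℝ} (hη : 0 < η)
    (hmin : ∀ p, ENNReal.ofReal η • ρ.map B.index ≤ ENNReal.ofReal 1 • B.estKernel ys p)
    {f : Fin M → U}
    (hf : IsAverageOptimal (BinPartition.estCost c xs) (B.estKernel ys) f) :
    ∃ w : Fin M → ℝ, (∀ i, w i = Finset.univ.inf' Finset.univ_nonempty
      (qValue 1 η (BinPartition.estCost c xs) (B.estKernel ys) (ρ.map B.index) w i)) ∧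
      ∀ i, qValue 1 η (BinPartition.estCost c xs) (B.estKernel ys) (ρ.map B.index) w i (f i)
        ≤ w i := by
  have : IsProbabilityMeasure (ρ.map B.index) :=
    Measure.isProbabilityMeasure_map B.measurable_index.aemeasurable
  obtain ⟨w₀, hw₀, hw₀b⟩ := exists_learned_fixedPoint hK xs ys zero_le_one hη.le (by linarith) hmin
  choose f₀ hf₀ using exists_qValue_eq_of_fixedPoint hw₀
  -- The fixed point shows that the optimality equation is solvable, so the given policy attains the
  -- minimum for some solution `(g, h)`, possibly a different one.
  obtain ⟨g, h, -, ⟨D, hD⟩, -, hgh, hfgh⟩ := hf.2 ⟨η * ∫ j, w₀ j ∂(ρ.map B.index), w₀, f₀,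
    .of_discrete, ⟨_, hw₀b⟩, .of_discrete, fun i => by
      have h1 := hw₀ i
      rw [Finset.inf'_univ_eq_ciInf] at h1
      have h2 : qValue 1 η (BinPartition.estCost c xs) (B.estKernel ys) (ρ.map B.index) w₀ i =
          fun u => BinPartition.estCost c xs i u + ∫ y, w₀ y ∂(B.estKernel ys (i, u)) -
            η * ∫ j, w₀ j ∂(ρ.map B.index) := by
        funext u
        unfold qValue
        ring
      rw [h2, ← ciInf_sub (Set.finite_range _).bddBelow] at h1
      linarith, fun i => by
      have h1 := hf₀ i
      unfold qValue at h1
      linarith⟩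
  -- Solutions `h` may be shifted by constants. This shift makes `η` times the mean of `h + a` equal
  -- to `g`, which turns `h + a` into a fixed point of the contractive operator.
  set a := (g - η * ∫ j, h j ∂(ρ.map B.index)) / η with ha
  have hηa : η * a = g - η * ∫ j, h j ∂(ρ.map B.index) := mul_div_cancel₀ _ hη.ne'
  have hshift (μ : Measure (Fin M)) [IsProbabilityMeasure μ] :
      ∫ j, (h j + a) ∂μ = ∫ j, h j ∂μ + a := by
    rw [integral_add .of_finite (integrable_const a)]
    simp
  have hq (i u) : qValue 1 η (BinPartition.estCost c xs) (B.estKernel ys) (ρ.map B.index)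
      (fun j => h j + a) i u =
      BinPartition.estCost c xs i u + ∫ y, h y ∂(B.estKernel ys (i, u)) - (g - a) := by
    unfold qValue
    rw [hshift, hshift]
    linear_combination -hηa
  refine ⟨fun j => h j + a, fun i => ?_, fun i => ?_⟩
  · rw [Finset.inf'_univ_eq_ciInf, funext (hq i), ← ciInf_sub (Set.finite_range _).bddBelow,
      ← hgh i]
    ring
  · rw [hq]
    linarith [hfgh i]

end FiniteModel

/-! ### Pathwise error bounds for the extended policy -/

section Error

variable {X U : Type*} [MetricSpace X] [SecondCountableTopology X] [MeasurableSpace X]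
  [BorelSpace X] [MetricSpace U] [MeasurableSpace U] [BorelSpace U] [Fintype U] [Nonempty U]
  {c : X → U → ℝ} {T : Kernel (X × U) X} [IsMarkovKernel T] {K : ℝ} {Lc LT : ℝ≥0}
  {M : ℕ} {B : BinPartition X M} {π : Measure X} [IsProbabilityMeasure π] {N₀ : ℕ} [NeZero N₀]

lemma IsWassersteinRegular.abs_cost_le (h : IsWassersteinRegular c T K Lc LT) (x : X) (u : U) :
    |c x u| ≤ K := by
  rw [abs_of_nonneg (h.cost_nonneg x u)]
  exact h.cost_le x u

/-- The error of the learned policy for the discounted cost, given the statistical error `E`. -/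
theorem discountedError_extend_le (h : IsWassersteinRegular c T K Lc LT)
    (hπ : ∀ i, 0 < π (B.bin i)) {β : ℝ} (hβ : 0 ≤ β) (hβ1 : β < 1) {v : X → ℝ}
    (hv : Measurable v) {D : ℝ} (hD : ∀ x, |v x| ≤ D)
    {L δ : ℝ} (hL : 0 ≤ L) (hvL : ∀ x y, |v x - v y| ≤ L * dist x y) (hLL : Lc + β * LT * L ≤ L)
    (hvfix : ∀ x, v x = Finset.univ.inf' Finset.univ_nonempty (qValue β 0 c T π v x))
    (hδ : ∀ x y, B.index x = B.index y → dist x y ≤ δ)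
    (xs ys : Fin N₀ → Fin M → U → X) {E : ℝ}
    (hE : ∀ i u, |empiricalDeviation B π β c T v xs ys i u| ≤ E) {f : Fin M → U}
    (hf : IsDiscountedOptimal β (BinPartition.estCost c xs) (B.estKernel ys) f) :
    discountedError β c T (B.extend f) (B.measurable_extend f) ≤
      ENNReal.ofReal ((L * δ + 2 * (3 * (L * δ) + E) / (1 - β)) / (1 - β)) := by
  have hmin (p : Fin M × U) :
      ENNReal.ofReal 0 • π.map B.index ≤ ENNReal.ofReal β • B.estKernel ys p := by
    rw [ENNReal.ofReal_zero, zero_smul]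
    exact Measure.zero_le _
  obtain ⟨w, hw, hwb⟩ := exists_learned_fixedPoint h.abs_cost_le xs ys hβ le_rfl
    (by linarith) hmin
  have hq := qValue_extend_sub_le h hπ hβ hβ1.le le_rfl zero_le_one (by linarith) hv hD hL hvL hLL
    hvfix hδ xs ys hE hmin hw (hf.greedy h.abs_cost_le hβ hβ1 hw hwb)
  rw [sub_zero] at hq
  have h1 := bellmanGap_nonneg_of_fixedPoint hvfix
  have h2 := exists_bellmanGap_nonpos_of_fixedPoint hvfix
  rw [zero_mul] at h1
  simp only [zero_mul] at h2
  refine iSup_le fun x => ENNReal.ofReal_le_ofReal ?_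
  have hopt := optDiscountedCost_eq (cost_measurable h) h.abs_cost_le T x hv hD hβ hβ1 h1 h2
  have hlow := le_discountedCost (cost_measurable h) h.abs_cost_le T
    (Policy.stationary (B.extend f) (B.measurable_extend f)) x hv hD hβ hβ1 h1
  have hup := discountedCost_stationary_le (cost_measurable h) h.abs_cost_le T x hv hD hβ hβ1
    (B.extend f) (B.measurable_extend f) fun y => by
      rw [bellmanGap_zero_eq_qValue_sub _ _ _ π]
      exact hq y
  rw [hopt, abs_of_nonneg (by linarith)]
  linarith

/-- The error of the learned policy for the average cost, given the statistical error `E` and a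
minorization of the learned model. -/
theorem averageError_extend_le (h : IsWassersteinRegular c T K Lc LT)
    (hπ : ∀ i, 0 < π (B.bin i)) {ρ : Measure X} [IsProbabilityMeasure ρ] {η : ℝ} (hη : 0 < η)
    (hη1 : η ≤ 1) {v : X → ℝ}
    (hv : Measurable v) {D : ℝ} (hD : ∀ x, |v x| ≤ D)
    {L δ : ℝ} (hL : 0 ≤ L) (hvL : ∀ x y, |v x - v y| ≤ L * dist x y) (hLL : Lc + 1 * LT * L ≤ L)
    (hvfix : ∀ x, v x = Finset.univ.inf' Finset.univ_nonempty (qValue 1 η c T ρ v x))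
    (hδ : ∀ x y, B.index x = B.index y → dist x y ≤ δ)
    (xs ys : Fin N₀ → Fin M → U → X) {E : ℝ}
    (hE : ∀ i u, |empiricalDeviation B π 1 c T v xs ys i u| ≤ E) {f : Fin M → U}
    (hmin : ∀ p, ENNReal.ofReal η • ρ.map B.index ≤ ENNReal.ofReal 1 • B.estKernel ys p)
    (hf : IsAverageOptimal (BinPartition.estCost c xs) (B.estKernel ys) f) :
    averageError c T (B.extend f) (B.measurable_extend f) ≤
      ENNReal.ofReal (L * δ + 2 * (3 * (L * δ) + E) / η) := by
  obtain ⟨w, hw, hwf⟩ := hf.exists_greedy h.abs_cost_le hη hmin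
  have hq := qValue_extend_sub_le h hπ zero_le_one le_rfl hη.le hη1 (by linarith) hv hD hL hvL hLL
    hvfix hδ xs ys hE hmin hw hwf
  rw [sub_sub_cancel] at hq
  have h1 := bellmanGap_nonneg_of_fixedPoint hvfix
  have h2 := exists_bellmanGap_nonpos_of_fixedPoint hvfix
  refine iSup_le fun x => ENNReal.ofReal_le_ofReal ?_
  have hopt := optAverageCost_eq (cost_measurable h) h.abs_cost_le T x hv hD _ h1 h2
  have hlow := le_averageCost (cost_measurable h) h.abs_cost_le T
    (Policy.stationary (B.extend f) (B.measurable_extend f)) x hv hD _ h1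
  have hup := averageCost_stationary_le (cost_measurable h) h.abs_cost_le T x hv hD _
    (B.extend f) (B.measurable_extend f) fun y => by
      rw [bellmanGap_eq_qValue_sub]
      exact hq y
  rw [hopt, abs_of_nonneg (by linarith)]
  linarith

/-- The crude bound for samples whose learned model may fail to be minorized: both average costs lie
in `[0, K]`. -/
lemma averageError_le (h : IsWassersteinRegular c T K Lc LT) (f : X → U) (hf : Measurable f) :
    averageError c T f hf ≤ ENNReal.ofReal K := by
  refine iSup_le fun x => ENNReal.ofReal_le_ofReal ?_
  have h0 (γ : Policy X U) : 0 ≤ averageCost c T γ x :=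
    averageCost_nonneg (cost_measurable h) h.abs_cost_le T γ x h.cost_nonneg
  have h1 : 0 ≤ optAverageCost c T x := Real.iInf_nonneg h0
  have h2 : optAverageCost c T x ≤ averageCost c T (Policy.stationary f hf) x :=
    ciInf_le ⟨0, by rintro _ ⟨γ, rfl⟩; exact h0 γ⟩ _
  have h3 := averageCost_le (cost_measurable h) h.abs_cost_le T (Policy.stationary f hf) x
  rw [abs_of_nonneg (by linarith)]
  linarith

end Error

/-! ### A single action -/

section Subsingleton

variable {S U : Type*} [MeasurableSpace S] [MeasurableSpace U] [Subsingleton U]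

/-- The only probability measure on one action is the trivial one. This case is set apart because
`log (M * |U|)` vanishes when `M = |U| = 1`, while the maximal inequality needs at least two pairs.
-/
instance : Subsingleton (Policy S U) where
  allEq γ γ' := by
    have h : γ.kernel = γ'.kernel := by
      funext t
      ext x s -
      rcases s.eq_empty_or_nonempty with rfl | hs
      · simp
      · rw [Subsingleton.eq_univ_of_nonempty hs, measure_univ, measure_univ]
    cases γ
    cases γ'
    simpa using h

variable (c : S → U → ℝ) (T : Kernel (S × U) S) [IsMarkovKernel T] (f : S → U)
  (hf : Measurable f)

lemma discountedError_of_subsingleton (β : ℝ) : discountedError β c T f hf = 0 := by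
  simp only [discountedError, optDiscountedCost,
    ciInf_subsingleton (Policy.stationary f hf), sub_self, abs_zero, ENNReal.ofReal_zero,
    ENNReal.iSup_zero]

lemma averageError_of_subsingleton : averageError c T f hf = 0 := by
  simp only [averageError, optAverageCost,
    ciInf_subsingleton (Policy.stationary f hf), sub_self, abs_zero, ENNReal.ofReal_zero,
    ENNReal.iSup_zero]

end Subsingleton

/-! ### Minorization of the learned model -/

section Minorization

variable {X U : Type*} [MeasurableSpace X] [MeasurableSpace U] [Fintype U]
  {T : Kernel (X × U) X} [IsMarkovKernel T]
  {M : ℕ} {B : BinPartition X M} {π ρ : Measure X} [IsProbabilityMeasure π]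
  [IsProbabilityMeasure ρ] {N₀ : ℕ} [NeZero N₀] {ε : ℝ}

/-- The constant is halved so that the same `η = ε / 2` serves the original and the learned model,
as the comparison of fixed points requires. -/
lemma IsMinorized.smul_le (h : IsMinorized T ρ ε) (p : X × U) :
    ENNReal.ofReal (ε / 2) • ρ ≤ ENNReal.ofReal 1 • T p := by
  refine Measure.le_iff.2 fun s hs => ?_
  rw [ENNReal.ofReal_one, one_smul, Measure.smul_apply, smul_eq_mul]
  refine le_trans ?_ (h p.1 p.2 s hs)
  rcases le_or_gt 0 ε with hε | hε
  · gcongr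
    linarith
  · rw [ENNReal.ofReal_of_nonpos (by linarith)]
    simp

lemma IsMinorized.le_one [Nonempty (X × U)] (h : IsMinorized T ρ ε) : ε ≤ 1 := by
  obtain ⟨x, u⟩ := ‹Nonempty (X × U)›
  simpa using h x u Set.univ .univ

lemma IsMinorized.mul_le_quantizedTransition (h : IsMinorized T ρ ε) (hε : 0 ≤ ε)
    (hπ : ∀ i, 0 < π (B.bin i)) (i j : Fin M) (u : U) :
    ε * ρ.real (B.bin j) ≤ B.quantizedTransition π T i u j := by
  have hpos : 0 < π.real (B.bin i) := ENNReal.toReal_pos (hπ i).ne' (measure_ne_top _ _)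
  rw [BinPartition.quantizedTransition, le_div_iff₀ hpos]
  have hT (x : X) : ε * ρ.real (B.bin j) ≤ (T (x, u)).real (B.bin j) := by
    have := ENNReal.toReal_mono (measure_ne_top _ _) (h x u (B.bin j) (B.measurableSet_bin j))
    rwa [ENNReal.toReal_mul, ENNReal.toReal_ofReal hε] at this
  have hm : Measurable fun x => (T (x, u)).real (B.bin j) :=
    ((T.measurable_coe (B.measurableSet_bin j)).comp (by fun_prop :
      Measurable fun x : X => (x, u))).ennreal_toReal
  have hi : Integrable (fun x => (T (x, u)).real (B.bin j)) (π.restrict (B.bin i)) :=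
    Integrable.of_bound hm.aestronglyMeasurable 1 (ae_of_all _ fun x => by
      rw [Real.norm_eq_abs, abs_of_nonneg measureReal_nonneg]
      exact measureReal_le_one)
  calc ε * ρ.real (B.bin j) * π.real (B.bin i)
      = ∫ _ in B.bin i, ε * ρ.real (B.bin j) ∂π := by simp [mul_comm]
    _ ≤ _ := integral_mono (integrable_const _) hi hT

variable [Countable U] [MeasurableSingletonClass U]

/-- If the estimated transition probabilities are at least half of the true ones, then the learned
model inherits half of the minorization. -/
lemma IsMinorized.smul_le_estKernel (h : IsMinorized T ρ ε) (hε : 0 ≤ ε)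
    (hπ : ∀ i, 0 < π (B.bin i)) {ys : Fin N₀ → Fin M → U → X}
    (hgood : ∀ i u j, B.quantizedTransition π T i u j / 2 ≤ B.estTransition ys i u j)
    (p : Fin M × U) :
    ENNReal.ofReal (ε / 2) • ρ.map B.index ≤ ENNReal.ofReal 1 • B.estKernel ys p := by
  rw [ENNReal.ofReal_one, one_smul]
  have hk : B.estKernel ys p =
      ∑ j, ENNReal.ofReal (B.estTransition ys p.1 p.2 j) • Measure.dirac j := rfl
  refine Measure.le_iff.2 fun s _ => ?_
  rw [← Measure.sum_smul_dirac (ρ.map B.index), hk, Measure.smul_apply, Measure.sum_fintype,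
    Measure.finsetSum_apply, Measure.finsetSum_apply, smul_eq_mul, Finset.mul_sum]
  refine Finset.sum_le_sum fun j _ => ?_
  rw [Measure.smul_apply, Measure.smul_apply, smul_eq_mul, smul_eq_mul, ← mul_assoc]
  refine mul_le_mul_left ?_ _
  have hj : (ρ.map B.index) {j} = ρ (B.bin j) := by
    rw [Measure.map_apply B.measurable_index (measurableSet_singleton j)]
    congr 1
    ext x
    exact B.index_eq_iff x j
  rw [hj, ← ofReal_measureReal, ← ENNReal.ofReal_mul (by positivity)]
  refine ENNReal.ofReal_le_ofReal ?_
  have h1 := h.mul_le_quantizedTransition hε hπ p.1 j p.2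
  have h2 := hgood p.1 p.2 j
  linarith

variable {Ω : Type*} [MeasurableSpace Ω] {P : Measure Ω} [IsProbabilityMeasure P]
  {xs ys : Ω → Fin N₀ → Fin M → U → X}

lemma kappa_nonneg : 0 ≤ B.kappa π T :=
  Real.sInf_nonneg fun _ hr => hr.1.le

/-- With high probability no estimated transition probability is less than half of the true one. -/
lemma IsTransitionSample.measure_exists_estTransition_lt_le
    (hs : IsTransitionSample P B π T xs ys) (hπ : ∀ i, 0 < π (B.bin i)) :
    P {ω | ∃ i u j, B.estTransition (ys ω) i u j < B.quantizedTransition π T i u j / 2} ≤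
      ENNReal.ofReal (M ^ 2 * Fintype.card U * Real.exp (-(B.kappa π T * N₀ / 8))) := by
  have hone (i : Fin M) (u : U) (j : Fin M) :
      P {ω | B.estTransition (ys ω) i u j < B.quantizedTransition π T i u j / 2} ≤
        ENNReal.ofReal (Real.exp (-(B.kappa π T * N₀ / 8))) := by
    -- A vanishing transition probability cannot be underestimated, so only nonzero ones, which are
    -- at least `kappa`, contribute to the union bound.
    rcases le_or_gt (B.quantizedTransition π T i u j) 0 with h0 | h0
    · have : {ω | B.estTransition (ys ω) i u j < B.quantizedTransition π T i u j / 2} = ∅ := by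
        ext ω
        have := B.estTransition_nonneg (ys ω) i u j
        simp only [Set.mem_ofPred_eq, Set.mem_empty_iff_false, iff_false, not_lt]
        linarith
      rw [this, measure_empty]
      exact zero_le
    · rw [← ofReal_measureReal]
      refine ENNReal.ofReal_le_ofReal
        ((hs.measureReal_estTransition_lt_le hπ i j u).trans (Real.exp_le_exp.2 ?_))
      have hκ : B.kappa π T ≤ B.quantizedTransition π T i u j :=
        csInf_le ⟨0, fun _ hr => hr.1.le⟩ ⟨h0, i, u, j, rfl⟩
      gcongr
  have hset : {ω | ∃ i u j, B.estTransition (ys ω) i u j <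
      B.quantizedTransition π T i u j / 2} = ⋃ t : Fin M × U × Fin M,
        {ω | B.estTransition (ys ω) t.1 t.2.1 t.2.2 <
          B.quantizedTransition π T t.1 t.2.1 t.2.2 / 2} := by
    ext ω
    simp
  rw [hset]
  refine (measure_iUnion_fintype_le _ _).trans
    ((Finset.sum_le_sum fun t _ => hone t.1 t.2.1 t.2.2).trans (le_of_eq ?_))
  rw [Finset.sum_const, Finset.card_univ, nsmul_eq_mul, Fintype.card_prod, Fintype.card_prod,
    Fintype.card_fin, ← ENNReal.ofReal_natCast, ← ENNReal.ofReal_mul (by positivity)]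
  congr 1
  push_cast
  ring

end Minorization

/-! ### From pathwise bounds to expectations -/

section Expectation

variable {Ω : Type*} [MeasurableSpace Ω] {P : Measure Ω} [IsProbabilityMeasure P]

/-- Neither `F` nor `A` has to be measurable: `F` is only compared with a majorant, and additivity
of the integral uses measurability of the term with `G` alone. -/
lemma lintegral_error_le {F : Ω → ℝ≥0∞} {G : Ω → ℝ} (hG : Integrable G P)
    {a₁ a₂ a₃ δ s C K : ℝ} (ha₁ : 0 ≤ a₁) (ha₂ : 0 ≤ a₂) (ha₃ : 0 ≤ a₃) (hδ : 0 ≤ δ)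
    (hs : 0 ≤ s) (hG0 : ∀ ω, 0 ≤ G ω) (hGs : ∫ ω, G ω ∂P ≤ a₃ * s) (hC : a₁ + a₂ * a₃ ≤ C)
    {A : Set Ω} (hF : ∀ ω, ω ∉ A → F ω ≤ ENNReal.ofReal (a₁ * δ + a₂ * G ω))
    (hFA : ∀ ω ∈ A, F ω ≤ ENNReal.ofReal K) :
    ∫⁻ ω, F ω ∂P ≤ ENNReal.ofReal C * (ENNReal.ofReal δ + ENNReal.ofReal s) +
      ENNReal.ofReal K * P A := by
  have hint : Integrable (fun ω => a₁ * δ + a₂ * G ω) P :=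
    (integrable_const _).add (hG.const_mul a₂)
  have hnn (ω) : 0 ≤ a₁ * δ + a₂ * G ω :=
    add_nonneg (mul_nonneg ha₁ hδ) (mul_nonneg ha₂ (hG0 ω))
  calc ∫⁻ ω, F ω ∂P
      ≤ ∫⁻ ω, (ENNReal.ofReal (a₁ * δ + a₂ * G ω) +
          A.indicator (fun _ => ENNReal.ofReal K) ω) ∂P := by
        refine lintegral_mono fun ω => ?_
        by_cases h : ω ∈ A
        · simpa [h] using (hFA ω h).trans le_add_self
        · simpa [h] using hF ω h
    _ = ∫⁻ ω, ENNReal.ofReal (a₁ * δ + a₂ * G ω) ∂P +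
          ∫⁻ ω, A.indicator (fun _ => ENNReal.ofReal K) ω ∂P :=
        lintegral_add_left' hint.aemeasurable.ennreal_ofReal _
    _ ≤ ENNReal.ofReal (C * (δ + s)) + ENNReal.ofReal K * P A := by
        refine add_le_add ?_ (lintegral_indicator_const_le _ _)
        rw [← ofReal_integral_eq_lintegral_ofReal hint (ae_of_all _ hnn)]
        refine ENNReal.ofReal_le_ofReal ?_
        rw [integral_add (integrable_const _) (hG.const_mul a₂), integral_const_mul a₂]
        simp only [integral_const, probReal_univ, smul_eq_mul, one_mul]
        have h1 := mul_le_mul_of_nonneg_left hGs ha₂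
        have h2 : a₁ * δ ≤ C * δ :=
          mul_le_mul_of_nonneg_right (by nlinarith [mul_nonneg ha₂ ha₃]) hδ
        have h3 : a₂ * a₃ * s ≤ C * s := mul_le_mul_of_nonneg_right (by linarith) hs
        linarith
    _ = _ := by
        rw [← ENNReal.ofReal_add hδ hs, ← ENNReal.ofReal_mul]
        nlinarith [mul_nonneg ha₂ ha₃]

variable {X U : Type*} [MetricSpace X] [MeasurableSpace X] {M : ℕ} {B : BinPartition X M}

lemma dist_le_toReal_mesh (h : B.mesh ≠ ∞) {x y : X} (hxy : B.index x = B.index y) :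
    dist x y ≤ B.mesh.toReal := by
  rw [dist_edist]
  refine ENNReal.toReal_mono h (le_trans ?_ (le_iSup (fun i => Metric.ediam (B.bin i)) (B.index y)))
  exact Metric.edist_le_ediam_of_mem (hxy ▸ B.mem_bin_index x) (B.mem_bin_index y)

variable [SecondCountableTopology X]
  [BorelSpace X] [MetricSpace U] [MeasurableSpace U] [BorelSpace U] [Fintype U] [Nonempty U]
  {c : X → U → ℝ} {T : Kernel (X × U) X} [IsMarkovKernel T] {K : ℝ} {Lc LT : ℝ≥0}
  {π : Measure X} [IsProbabilityMeasure π] {N₀ : ℕ} [NeZero N₀]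
  {xs ys : Ω → Fin N₀ → Fin M → U → X}

/-- The expectation of the largest deviation of the empirical state-action values. -/
lemma IsTransitionSample.exists_integrable_forall_abs_empiricalDeviation_le
    (hs : IsTransitionSample P B π T xs ys) (h : IsWassersteinRegular c T K Lc LT)
    (hπ : ∀ i, 0 < π (B.bin i)) (hU : 2 ≤ Fintype.card U)
    {v : X → ℝ} (hv : Measurable v) {D : ℝ} (hD : ∀ x, |v x| ≤ D)
    {β : ℝ} (hβ : 0 ≤ β) (hβ1 : β ≤ 1) :
    ∃ G : Ω → ℝ, Integrable G P ∧ (∀ ω, 0 ≤ G ω) ∧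
      (∀ ω i u, |empiricalDeviation B π β c T v (xs ω) (ys ω) i u| ≤ G ω) ∧
      ∫ ω, G ω ∂P ≤ (4 + (K + D) ^ 2 / 2) * √(Real.log (M * Fintype.card U) / N₀) := by
  obtain ⟨x₀⟩ : Nonempty X := nonempty_of_isProbabilityMeasure π
  have hM : 1 ≤ M := Fin.pos (B.index x₀)
  have hcard : 2 ≤ Fintype.card (Fin M × U) := by
    rw [Fintype.card_prod, Fintype.card_fin]
    nlinarith
  choose σ hσ hσs using fun p : Fin M × U =>
    hs.hasSubgaussianMGF hπ (cost_measurable h) h.abs_cost_le hv hD hβ hβ1 p.1 p.2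
  obtain ⟨G, hG, hZ, hGi⟩ := exists_integrable_forall_abs_le hcard (NeZero.ne N₀) hσ hσs
  refine ⟨G, hG, fun ω => (abs_nonneg _).trans (hZ (B.index x₀, Classical.arbitrary U) ω),
    fun ω i u => hZ (i, u) ω, ?_⟩
  simpa using hGi

end Expectation

end MDP

end

/-! ### The main theorem: choice of constants -/

theorem mainTheorem8 :
    (∀ (β K : ℝ) (Lc LT : ℝ≥0), 0 < β → β < 1 → β * LT < 1 →
      ∃ C : ℝ, 0 < C ∧
        ∀ (X : Type*) [MetricSpace X] [CompleteSpace X] [SecondCountableTopology X]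
          [MeasurableSpace X] [BorelSpace X]
          (U : Type*) [MetricSpace U] [Fintype U] [Nonempty U] [MeasurableSpace U] [BorelSpace U]
          (c : X → U → ℝ) (T : Kernel (X × U) X) [IsMarkovKernel T]
          (M : ℕ) (B : MDP.BinPartition X M) (π : Measure X) [IsProbabilityMeasure π]
          (N₀ : ℕ) [NeZero N₀]
          (Ω : Type*) [MeasurableSpace Ω] (P : Measure Ω) [IsProbabilityMeasure P]
          (xs ys : Ω → Fin N₀ → Fin M → U → X) (γhat : Ω → Fin M → U),
          MDP.IsWassersteinRegular c T K Lc LT →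
          (∀ i, 0 < π (B.bin i)) →
          MDP.IsTransitionSample P B π T xs ys →
          Measurable γhat →
          (∀ ω, MDP.IsDiscountedOptimal β (MDP.BinPartition.estCost c (xs ω))
            (B.estKernel (ys ω)) (γhat ω)) →
          ∫⁻ ω, MDP.discountedError β c T (B.extend (γhat ω)) (B.measurable_extend (γhat ω)) ∂P
            ≤ ENNReal.ofReal C *
              (B.mesh + ENNReal.ofReal √(Real.log (M * Fintype.card U) / N₀))) ∧
    (∀ (ε K : ℝ) (Lc LT : ℝ≥0), 0 < ε → LT < 1 →
      ∃ C : ℝ, 0 < C ∧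
        ∀ (X : Type*) [MetricSpace X] [CompleteSpace X] [SecondCountableTopology X]
          [MeasurableSpace X] [BorelSpace X]
          (U : Type*) [MetricSpace U] [Fintype U] [Nonempty U] [MeasurableSpace U] [BorelSpace U]
          (c : X → U → ℝ) (T : Kernel (X × U) X) [IsMarkovKernel T]
          (ρ : Measure X) [IsProbabilityMeasure ρ]
          (M : ℕ) (B : MDP.BinPartition X M) (π : Measure X) [IsProbabilityMeasure π]
          (N₀ : ℕ) [NeZero N₀]
          (Ω : Type*) [MeasurableSpace Ω] (P : Measure Ω) [IsProbabilityMeasure P]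
          (xs ys : Ω → Fin N₀ → Fin M → U → X) (γhat : Ω → Fin M → U),
          MDP.IsWassersteinRegular c T K Lc LT →
          MDP.IsMinorized T ρ ε →
          (∀ i, 0 < π (B.bin i)) →
          MDP.IsTransitionSample P B π T xs ys →
          Measurable γhat →
          (∀ ω, MDP.IsAverageOptimal (MDP.BinPartition.estCost c (xs ω))
            (B.estKernel (ys ω)) (γhat ω)) →
          ∫⁻ ω, MDP.averageError c T (B.extend (γhat ω)) (B.measurable_extend (γhat ω)) ∂P
            ≤ ENNReal.ofReal C *
                (B.mesh + ENNReal.ofReal √(Real.log (M * Fintype.card U) / N₀)) +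
              ENNReal.ofReal (C * M ^ 2 * Fintype.card U *
                Real.exp (-(C⁻¹ * B.kappa π T * N₀)))) := by
  refine ⟨fun β K Lc LT hβ hβ1 hβLT => ?_, fun ε K Lc LT hε hLT => ?_⟩
  · have hLT0 : 0 < 1 - β * (LT : ℝ) := by linarith
    have hβ0 : 0 < 1 - β := by linarith
    -- The solution of `Lc + β * LT * L = L`.
    set L : ℝ := Lc / (1 - β * LT) with hL_def
    have hL : 0 ≤ L := div_nonneg Lc.2 hLT0.le
    have hLL : Lc + β * LT * L ≤ L := by
      have : L * (1 - β * LT) = Lc := div_mul_cancel₀ _ hLT0.ne'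
      linarith
    set D : ℝ := K / (1 - β) with hD_def
    -- The pathwise bound of `discountedError_extend_le` is `a₁ * δ + a₂ * E`, and `a₃` is the
    -- constant of the maximal inequality. The summand 1 in the final constant makes it positive.
    set a₁ : ℝ := (L + 6 * L / (1 - β)) / (1 - β) with ha₁_def
    set a₂ : ℝ := 2 / (1 - β) / (1 - β) with ha₂_def
    set a₃ : ℝ := 4 + (K + D) ^ 2 / 2 with ha₃_def
    have ha₁ : 0 ≤ a₁ := by positivity
    have ha₂ : 0 ≤ a₂ := by positivity
    have ha₃ : 0 ≤ a₃ := by positivity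
    refine ⟨a₁ + a₂ * a₃ + 1, by positivity, ?_⟩
    intro X _ _ _ _ _ U _ _ _ _ _ c T _ M B π _ N₀ _ Ω _ P _ xs ys γhat hreg hπ hsample _ hopt
    have hC0 : ENNReal.ofReal (a₁ + a₂ * a₃ + 1) ≠ 0 :=
      (ENNReal.ofReal_pos.2 (by positivity)).ne'
    -- For an infinite mesh the right-hand side is infinite.
    rcases eq_or_ne B.mesh ∞ with hmesh | hmesh
    · rw [hmesh, top_add, ENNReal.mul_top hC0]
      exact le_top
    rcases subsingleton_or_nontrivial U with hU | hU
    · simp [MDP.discountedError_of_subsingleton]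
    have hmin (p : X × U) : ENNReal.ofReal 0 • π ≤ ENNReal.ofReal β • T p := by
      rw [ENNReal.ofReal_zero, zero_smul]
      exact Measure.zero_le _
    obtain ⟨v, hv, hvL, hvfix, hvD⟩ := hreg.exists_lipschitz_fixedPoint hβ.le le_rfl
      (by linarith) hmin hL hLL
    rw [sub_zero] at hvD
    obtain ⟨G, hG, hG0, hGE, hGi⟩ :=
      hsample.exists_integrable_forall_abs_empiricalDeviation_le hreg hπ
        Fintype.one_lt_card hv.measurable hvD hβ.le hβ1.le
    have h := MDP.lintegral_error_le hG ha₁ ha₂ ha₃ ENNReal.toReal_nonneg (Real.sqrt_nonneg _)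
      hG0 hGi (by linarith : a₁ + a₂ * a₃ ≤ a₁ + a₂ * a₃ + 1) (A := ∅) (K := 0)
      (F := fun ω => MDP.discountedError β c T (B.extend (γhat ω)) (B.measurable_extend (γhat ω)))
      (fun ω _ => by
        refine (MDP.discountedError_extend_le hreg hπ hβ.le hβ1 hv.measurable hvD hL hvL hLL
          hvfix (fun x y => MDP.dist_le_toReal_mesh hmesh) (xs ω) (ys ω) (hGE ω)
          (hopt ω)).trans_eq ?_
        rw [ha₁_def, ha₂_def]
        congr 1
        field_simp
        ring) (fun ω hω => hω.elim)
    rwa [ENNReal.ofReal_toReal hmesh, measure_empty, mul_zero, add_zero] at h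
  · have hLT0 : 0 < 1 - (LT : ℝ) := sub_pos.2 (by exact_mod_cast hLT)
    set L : ℝ := Lc / (1 - LT) with hL_def
    have hL : 0 ≤ L := div_nonneg Lc.2 hLT0.le
    have hLL : Lc + 1 * LT * L ≤ L := by
      have : L * (1 - LT) = Lc := div_mul_cancel₀ _ hLT0.ne'
      linarith
    set D : ℝ := K / (ε / 2) with hD_def
    set a₁ : ℝ := L + 6 * L / (ε / 2) with ha₁_def
    set a₂ : ℝ := 2 / (ε / 2) with ha₂_def
    set a₃ : ℝ := 4 + (K + D) ^ 2 / 2 with ha₃_def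
    have ha₁ : 0 ≤ a₁ := by positivity
    have ha₂ : 0 ≤ a₂ := by positivity
    have ha₃ : 0 ≤ a₃ := by positivity
    -- The term `|K|` pays for the error on the exceptional event, and 8 gives `C⁻¹ ≤ 1 / 8`, as the
    -- Chernoff exponent demands.
    set C : ℝ := a₁ + a₂ * a₃ + |K| + 8 with hC_def
    have hCpos : 0 < C := by positivity
    have hCa : a₁ + a₂ * a₃ ≤ C := by linarith [abs_nonneg K]
    have hC8 : 8 ≤ C := by linarith [abs_nonneg K, mul_nonneg ha₂ ha₃]
    have hCK : K ≤ C := by linarith [le_abs_self K, mul_nonneg ha₂ ha₃]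
    refine ⟨C, hCpos, ?_⟩
    intro X _ _ _ _ _ U _ _ _ _ _ c T _ ρ _ M B π _ N₀ _ Ω _ P _ xs ys γhat hreg hρ hπ hsample _
      hopt
    have hC0 : ENNReal.ofReal C ≠ 0 := (ENNReal.ofReal_pos.2 hCpos).ne'
    rcases eq_or_ne B.mesh ∞ with hmesh | hmesh
    · rw [hmesh, top_add, ENNReal.mul_top hC0, top_add]
      exact le_top
    rcases subsingleton_or_nontrivial U with hU | hU
    · simp [MDP.averageError_of_subsingleton]
    have : Nonempty X := nonempty_of_isProbabilityMeasure π
    have hε1 : ε ≤ 1 := hρ.le_one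
    obtain ⟨v, hv, hvL, hvfix, hvD⟩ := hreg.exists_lipschitz_fixedPoint zero_le_one
      (by positivity) (by linarith) hρ.smul_le hL hLL
    rw [sub_sub_cancel] at hvD
    obtain ⟨G, hG, hG0, hGE, hGi⟩ :=
      hsample.exists_integrable_forall_abs_empiricalDeviation_le hreg hπ
        Fintype.one_lt_card hv.measurable hvD zero_le_one le_rfl
    refine (MDP.lintegral_error_le hG ha₁ ha₂ ha₃ ENNReal.toReal_nonneg (Real.sqrt_nonneg _)
      hG0 hGi hCa (K := K) (δ := B.mesh.toReal)
      (F := fun ω => MDP.averageError c T (B.extend (γhat ω)) (B.measurable_extend (γhat ω)))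
      (A := {ω | ∃ i u j, B.estTransition (ys ω) i u j < B.quantizedTransition π T i u j / 2})
      (fun ω hω => ?_) fun ω _ => MDP.averageError_le hreg _ _).trans ?_
    · simp only [Set.mem_ofPred_eq, not_exists, not_lt] at hω
      refine (MDP.averageError_extend_le hreg hπ (by positivity) (by linarith) hv.measurable hvD
        hL hvL hLL hvfix (fun x y => MDP.dist_le_toReal_mesh hmesh) (xs ω) (ys ω) (hGE ω)
        (hρ.smul_le_estKernel hε.le hπ hω) (hopt ω)).trans_eq ?_
      rw [ha₁_def, ha₂_def]
      congr 1
      field_simp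
      ring
    · rw [ENNReal.ofReal_toReal hmesh]
      refine add_le_add_right ?_ _
      refine (mul_le_mul_right (hsample.measure_exists_estTransition_lt_le hπ) _).trans ?_
      have hκ : 0 ≤ B.kappa π T * N₀ := mul_nonneg MDP.kappa_nonneg (Nat.cast_nonneg _)
      have hexp : Real.exp (-(B.kappa π T * N₀ / 8)) ≤
          Real.exp (-(C⁻¹ * B.kappa π T * N₀)) := by
        refine Real.exp_le_exp.2 (neg_le_neg ?_)
        rw [mul_assoc, div_eq_inv_mul]
        exact mul_le_mul_of_nonneg_right (inv_anti₀ (by norm_num) hC8) hκ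
      calc _ ≤ ENNReal.ofReal C * ENNReal.ofReal
            (M ^ 2 * Fintype.card U * Real.exp (-(C⁻¹ * B.kappa π T * N₀))) := by
            gcongr
        _ = _ := by
            rw [← ENNReal.ofReal_mul hCpos.le]
            congr 1
            ring
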